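/- Let $p$ be an odd prime, $\zeta_p$ a primitive $p$-th root of unity, $K=\mathbb Q(\zeta_p)$ with ring of integers $\mathbb Z[\zeta_p]$, and $\pi=(\zeta_p-1)\mathbb Z[\zeta_p]$. Let $v$ be a primitive root modulo $p$; for $k\in\mathbb Z$ write $v^k$ for the integer with $1\le v^k\le p-1$ congruent to the $k$-th power of $v$ modulo $p$ (in particular $v=v^1$). Let $\sigma\in G_p=\mathrm{Gal}(K/\mathbb Q)$ be given by $\sigma(\zeta_p)=\zeta_p^{v}$, let the bar denote complex conjugation on $K$, and for $x\in K^\ast$ and $\theta=\sum_{\tau\in G_p} n_\tau\tau\in\mathbb Z[G_p]$ put $x^\theta=\prod_\tau \tau(x)^{n_\tau}$. Put $$P(\sigma)=\sum_{i=0}^{p-2}v^{-i}\sigma^i,\qquad \delta_i=\frac{v^{-(i-1)}-v^{-i}\,v}{p}\in\mathbb Z,$$ $$Q_1(\sigma)=(1-\sigma)\sum_{i=0}^{(p-3)/2}\delta_i\,\sigma^i+(1-v)\,\sigma^{(p-1)/2}\in\mathbb Z[G_p].$$ Let $\Gamma$ be a subgroup of order $p$ of the class group of $K$ on which $\sigma$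 acts as $c\mapsto c^{\mu}$, where $\mu\equiv v^n\pmod p$ with $1<n\le p-2$. Let $q\ne p$ be an odd prime and $\mathfrak q$ a prime ideal of $\mathbb Z[\zeta_p]$ above $q$, of any inertial degree, with $\mathrm{Cl}(\mathfrak q)\in\Gamma$. Let $A\in\mathbb Z[\zeta_p]$ be a singular integer (that is, $A$ is not a $p$-th power in $K$ and $A\,\mathbb Z[\zeta_p]$ is the $p$-th power of an ideal) with $A\,\mathbb Z[\zeta_p]=\mathfrak q^p$ and $A\equiv a\pmod{\pi^n}$ for some natural number $a$. Let $F=\mathbb Z[\zeta_p]/\mathfrak q$ and $m=|F|$, let $\zeta_q$ be a primitive $q$-th root of unity, and define the Gauss sum $$g(\mathfrak q)=\sum_{x\in F}\chi(x)\,\zeta_q^{\mathrm{Tr}_{F/\mathbb F_q}(x)}\in\mathbb Z[\zeta_p,\zeta_q],$$ where $\chi(0)=0$ and, for $x\ne0$, $\chi(x)$ is the inverse of the $p$-th root of unity congruent to $x^{(m-1)/p}$ modulo $\mathfrak q$. Then: 1. $g(\mathfrak q)^{p^2}=\pm A^{P(\sigma)}$. 2. $g(\mathfrak q)^p\in\mathbb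 Z[\zeta_p]$, and $$g(\mathfrak q)^{p(\sigma-1)(\sigma-v)}=\pm\left(\frac{\overline A}{A}\right)^{Q_1(\sigma)},$$ where the left side means $\bigl(g(\mathfrak q)^p\bigr)^{(\sigma-1)(\sigma-v)}$. -/

import Mathlib

open scoped NumberField

namespace KummerStickelberger

open NumberField

section Exponents

variable {p : ℕ} [Fact p.Prime]

/-- The convention `v ^ k` for `k : ℤ`: the integer representative of `v ^ k mod p` that lies
between `1` and `p - 1`. In particular `vpow v 1` is `v` itself as an integer. -/
def vpow (v : (ZMod p)ˣ) (k : ℤ) : ℤ := (((v ^ k : (ZMod p)ˣ) : ZMod p).val : ℤ)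

/-- `δ_i = (v^{-(i-1)} - v^{-i} v) / p`. The division is exact, see `p_mul_delta`. -/
def delta (v : (ZMod p)ˣ) (i : ℕ) : ℤ :=
  (vpow v (-((i : ℤ) - 1)) - vpow v (-(i : ℤ)) * vpow v 1) / (p : ℤ)

theorem p_mul_delta (v : (ZMod p)ˣ) (i : ℕ) :
    (p : ℤ) * delta v i = vpow v (-((i : ℤ) - 1)) - vpow v (-(i : ℤ)) * vpow v 1 := by
  refine Int.mul_ediv_cancel' ?_
  rw [← ZMod.intCast_zmod_eq_zero_iff_dvd]
  have h : ∀ k : ℤ, ((vpow v k : ℤ) : ZMod p) = ((v ^ k : (ZMod p)ˣ) : ZMod p) := fun k => by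
    simp [vpow, -Units.val_zpow_eq_zpow_val]
  rw [Int.cast_sub, Int.cast_mul, h, h, h, ← Units.val_mul, ← zpow_add, sub_eq_zero]
  congr 2
  ring

end Exponents

section GroupRing

variable {K : Type*} [Field K] [CharZero K]

/-- The action of the integral group ring of `Gal(K/ℚ)` on `K`, written exponentially:
`x ^ (∑ n_g g) = ∏ (g x) ^ n_g`. -/
noncomputable def galPow (x : K) (θ : MonoidAlgebra ℤ (K ≃ₐ[ℚ] K)) : K :=
  θ.coeff.prod fun g n => (g x) ^ n

/-- `σ` as an element of the group ring `ℤ[Gal(K/ℚ)]`. -/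
noncomputable def grp (σ : K ≃ₐ[ℚ] K) : MonoidAlgebra ℤ (K ≃ₐ[ℚ] K) := MonoidAlgebra.single σ 1

variable {p : ℕ} [Fact p.Prime]

/-- `P(σ) = ∑_{i=0}^{p-2} v^{-i} σ^i`. -/
noncomputable def P (v : (ZMod p)ˣ) (σ : K ≃ₐ[ℚ] K) : MonoidAlgebra ℤ (K ≃ₐ[ℚ] K) :=
  ∑ i ∈ Finset.range (p - 1), vpow v (-(i : ℤ)) • grp σ ^ i

/-- `Q₁(σ) = (1 - σ) ∑_{i=0}^{(p-3)/2} δ_i σ^i + (1 - v) σ^{(p-1)/2}`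
(for odd `p`, `Finset.range ((p - 1) / 2)` is `{0, …, (p-3)/2}`). -/
noncomputable def Q₁ (v : (ZMod p)ˣ) (σ : K ≃ₐ[ℚ] K) : MonoidAlgebra ℤ (K ≃ₐ[ℚ] K) :=
  (1 - grp σ) * ∑ i ∈ Finset.range ((p - 1) / 2), delta v i • grp σ ^ i
    + (1 - vpow v 1) • grp σ ^ ((p - 1) / 2)

end GroupRing

section GaussSum

variable {K : Type*} [Field K] [NumberField K]

open Classical in
/-- The `p`-th power residue symbol modulo `𝔮`, as a function on the residue field `𝓞 K ⧸ 𝔮` with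
`m` elements: for `x ≠ 0` it is the `p`-th root of unity `ξ` of `K` such that
`x ^ ((m - 1) / p) = ξ` modulo `𝔮` (it exists and is unique when `K` contains the `p`-th roots of
unity and `p ∉ 𝔮`), and it is `0` at `x = 0`. -/
noncomputable def powerResidue (p : ℕ) (𝔮 : Ideal (𝓞 K)) (x : 𝓞 K ⧸ 𝔮) : 𝓞 K :=
  if h : x ≠ 0 ∧ ∃ ξ : 𝓞 K,
      ξ ^ p = 1 ∧ x ^ ((Nat.card (𝓞 K ⧸ 𝔮) - 1) / p) = Ideal.Quotient.mk 𝔮 ξ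
  then h.2.choose else 0

/-- The character of the residue field at `𝔮` inverse to the `p`-th power residue symbol, extended
by `0` at `0`, with values in `K`. -/
noncomputable def residueChar (p : ℕ) (𝔮 : Ideal (𝓞 K)) (x : 𝓞 K ⧸ 𝔮) : K :=
  ((powerResidue p 𝔮 x : 𝓞 K) : K)⁻¹

/-- The trace from the residue field `𝓞 K ⧸ 𝔮` to its prime field `ℤ ⧸ (q)`, identified with
`ZMod q`. -/
noncomputable def residueTrace (q : ℕ) (𝔮 : Ideal (𝓞 K)) [𝔮.LiesOver (Ideal.span {(q : ℤ)})]
    (x : 𝓞 K ⧸ 𝔮) : ZMod q :=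
  Int.quotientSpanNatEquivZMod q
    (Algebra.trace (ℤ ⧸ Ideal.span {(q : ℤ)}) (𝓞 K ⧸ 𝔮) x)

/-- The `p`-th power residue Gauss sum `g(𝔮) = ∑ χ(x) ζ_q ^ Tr(x)`, where `x` runs through the
(finite) residue field `𝓞 K ⧸ 𝔮` and `χ` is the inverse of the `p`-th power residue symbol. -/
noncomputable def gauss (p q : ℕ) (𝔮 : Ideal (𝓞 K)) [𝔮.LiesOver (Ideal.span {(q : ℤ)})]
    {L : Type*} [Field L] [Algebra K L] (ζq : L) : L :=
  ∑ᶠ x : 𝓞 K ⧸ 𝔮, algebraMap K L (residueChar p 𝔮 x) * ζq ^ (residueTrace q 𝔮 x).val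

end GaussSum

section Singular

variable {K : Type*} [Field K] [NumberField K]

/-- `A` is a singular integer: it is not a `p`-th power in `K`, but the ideal it generates is the
`p`-th power of an ideal. -/
def IsSingular (p : ℕ) (A : 𝓞 K) : Prop :=
  (¬ ∃ B : K, B ^ p = (A : K)) ∧ ∃ 𝔞 : Ideal (𝓞 K), Ideal.span {A} = 𝔞 ^ p

/-- A subgroup `Γ` of the class group is annihilated by `σ - μ`: `σ` acts on `Γ` as raising to the
power `μ` (used for `Γ` of order `p`, where the power depends only on `μ` modulo `p`). -/
def IsAnnihilatedBy {p : ℕ} (Γ : Subgroup (ClassGroup (𝓞 K))) (σ : K ≃ₐ[ℚ] K)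
    (μ : (ZMod p)ˣ) : Prop :=
  ∀ c ∈ Γ, ClassGroup.mulEquiv (RingOfIntegers.mapRingEquiv σ.toRingEquiv) c =
    c ^ (μ : ZMod p).val

end Singular

end KummerStickelberger

/-!
# The Gauss sum of a prime whose `p`-th power is principal

Put `g = g(𝔮)`, `h = (p - 1) / 2` and `π = ζ - 1`. The `p`-th power `G = g ^ p` is a product of
Jacobi sums and so lies in `𝓞 K` (`gaussPow`), and `J G * G = m ^ p`.

The arithmetic input is half of Stickelberger's theorem: `𝔮 ^ P(σ)` divides `G`
(`prod_conjIdeal_dvd_gaussPow`). Over the ring of algebraic integers one has a Teichmüller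
character `ω` of the residue field, with respect to a prime `𝔔` above `𝔮`, and the character of `g`
is a power of `ω⁻¹`. From `g(ω⁻¹) g(ω⁻ᵃ) = J(ω⁻ᵃ, ω⁻¹) g(ω⁻⁽ᵃ⁺¹⁾)` with
`J(ω⁻ᵃ, ω⁻¹) ≡ -(a + 1)` modulo `𝔔`, and from the invariance of Gauss sums under Frobenius, one gets
that `g(ω⁻ᵏ)` is divisible at `𝔔` by `ζ_q - 1` to the power the sum of the digits of `k` in base `q`
(`exists_pow_dvd_mul_gaussSum`). As `q` is unramified in `K`, this descends to a lower bound for the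
`𝔮`-adic valuation of every conjugate of `G` (`gaussPow_mem_pow`); the decomposition group of `𝔮`
consists of powers of `ζ ↦ ζ ^ q`, so these bounds reach the exponents of `𝔮 ^ P(σ)`.

Hence `G ^ p = A ^ P(σ) * U` with `U` integral. No upper bound for the valuations is needed:
`J (A ^ P(σ)) * A ^ P(σ)` is the `p`-th power of the norm `± m ^ p` of `A`, so `J U * U = ± 1`, all
absolute values of `U` are `1` and `U` is a root of unity, that is `± ζ ^ r`. The exponent `r` is
found modulo `π ^ 2`: `A` is congruent to a rational integer because `n ≥ 2`, `G` is congruent to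
`-1`, and the numbers congruent to rational integers prime to `p` (`IsSemiprimary`) form a
Galois-stable group which contains no `ζ ^ r ≠ 1`. So `U = ± 1`.

The second assertion is formal. Let `Q = ∑ δ_i σ^i`, summed over `0 ≤ i ≤ p - 2`. Then
`(σ - v) P = p Q`, so that `G ^ (σ - v)` and `A ^ Q` have the same `p`-th power up to sign; both are
semiprimary, hence they agree up to sign. Finally `(σ - 1) Q = Q₁ (σ ^ h - 1)`, because
`δ_{i + h} = 1 - v - δ_i`, and `σ ^ h` is complex conjugation.
-/

/-! ### A sum over a finite field and sums of residues -/

section Stickelberger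

/-- After the substitution `x ↦ x⁻¹` the summand is, up to `(x - 1)⁻¹`, the geometric progression
`1 + x + ⋯ + x ^ a`, except at `x = 1`. Sums of powers `x ^ i` over `F` with `i < #F - 1` vanish, so
only the correction at `x = 1` survives, where the progression takes the value `a + 1`. -/
theorem sum_inv_pow_mul_one_sub_inv {F : Type*} [Field F] [Fintype F] {a : ℕ} (ha : 1 ≤ a)
    (ha' : a + 1 < Fintype.card F - 1) :
    ∑ x : F, (x⁻¹) ^ a * (1 - x)⁻¹ = -((a + 1 : ℕ) : F) := by
  classical
  have key : ∀ x : F, x ^ a * (1 - x⁻¹)⁻¹ =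
      ∑ i ∈ Finset.range (a + 1), x ^ i + (x - 1)⁻¹ - if x = 1 then ((a + 1 : ℕ) : F) else 0 := by
    intro x
    rcases eq_or_ne x 0 with rfl | hx0
    · rw [zero_pow (by lia), Finset.sum_range_succ']
      simp [inv_neg]
    rcases eq_or_ne x 1 with rfl | hx1
    · simp
    · have h1 : x - 1 ≠ 0 := sub_ne_zero.mpr hx1
      rw [if_neg hx1, geom_sum_eq hx1, sub_zero]
      field_simp
      ring
  have h1 : ∑ x : F, x⁻¹ = 0 := by
    rw [← Equiv.sum_comp (Equiv.inv F)]
    simpa using FiniteField.sum_pow_lt_card_sub_one F 1 (by lia)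
  have h2 : ∑ x : F, (x - 1)⁻¹ = 0 := by
    rw [← h1, ← Equiv.sum_comp (Equiv.subRight (1 : F)) (fun x => x⁻¹)]
    rfl
  rw [← Equiv.sum_comp (Equiv.inv F)]
  simp only [Equiv.inv_apply, inv_inv, key]
  rw [Finset.sum_sub_distrib, Finset.sum_add_distrib, h2, Finset.sum_comm,
    Finset.sum_eq_zero fun i hi => FiniteField.sum_pow_lt_card_sub_one F i
      (by rw [Finset.mem_range] at hi; lia)]
  simp

/-- The sum of the residues modulo `q ^ f - 1` of the numbers `q ^ l * k`, `l < f`; for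
`k < q ^ f - 1` it is `(q ^ f - 1) / (q - 1)` times the sum of the digits of `k` in base `q`. -/
def residueSum (q f k : ℕ) : ℕ := ∑ l ∈ Finset.range f, (q ^ l * k) % (q ^ f - 1)

theorem residueSum_zero (q f : ℕ) : residueSum q f 0 = 0 := by simp [residueSum]

theorem residueSum_add_one_mul_le {q : ℕ} (hq : 1 ≤ q) (f k : ℕ) :
    residueSum q f (k + 1) * (q - 1) ≤ residueSum q f k * (q - 1) + (q ^ f - 1) := by
  have h : residueSum q f (k + 1) ≤ residueSum q f k + ∑ l ∈ Finset.range f, q ^ l := by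
    rw [residueSum, residueSum, ← Finset.sum_add_distrib]
    refine Finset.sum_le_sum fun l _ => ?_
    rw [mul_add, mul_one]
    rw [Nat.add_mod]
    exact (Nat.mod_le _ _).trans (Nat.add_le_add_left (Nat.mod_le _ _) _)
  calc _ ≤ (residueSum q f k + ∑ l ∈ Finset.range f, q ^ l) * (q - 1) := by gcongr
    _ = _ := by
      obtain ⟨r, rfl⟩ := Nat.exists_eq_add_of_le' hq
      rw [add_mul, Nat.add_sub_cancel, ← geom_sum_mul_add r f, Nat.add_sub_cancel]

theorem residueSum_mul_left {q f : ℕ} (hq : 1 ≤ q) (k : ℕ) :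
    residueSum q f (q * k) = residueSum q f k := by
  have h : q ^ f * k % (q ^ f - 1) = q ^ 0 * k % (q ^ f - 1) := by
    conv_lhs => rw [show q ^ f * k = (q ^ f - 1) * k + q ^ 0 * k by
      rw [pow_zero, ← add_mul, Nat.sub_add_cancel (Nat.one_le_pow f q hq)]]
    rw [Nat.mul_add_mod]
  rcases f with _ | f
  · simp [residueSum]
  · unfold residueSum
    rw [Finset.sum_range_succ, Finset.sum_range_succ', ← h]
    simp only [← mul_assoc, ← pow_succ]

/-! ### Stickelberger's bound -/

variable {F : Type*} [Field F] [Fintype F] {R : Type*} [CommRing R]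
  {𝔔 : Ideal R} {ι : F →+* R ⧸ 𝔔} {ω : MulChar F R}

/-- A character lifting an embedding of `F` into a residue ring (a Teichmüller character) has
order at least `#F - 1`. -/
theorem inv_pow_ne_one_of_lift [Nontrivial (R ⧸ 𝔔)]
    (hω : ∀ x, Ideal.Quotient.mk 𝔔 (ω x) = ι x) {k : ℕ} (hk : 0 < k)
    (hk' : k < Fintype.card F - 1) : ω⁻¹ ^ k ≠ 1 := by
  classical
  rw [inv_pow, inv_ne_one]
  intro h
  obtain ⟨g, hg⟩ := IsCyclic.exists_generator (α := Fˣ)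
  have h1 : (g : F) ^ k = 1 := by
    apply ι.injective
    rw [map_pow, map_one, ← hω, ← map_pow, ← MulChar.pow_apply_coe, h, MulChar.one_apply_coe,
      map_one]
  have h2 : orderOf g = Fintype.card F - 1 := by
    rw [orderOf_eq_card_of_forall_mem_zpowers hg, Nat.card_eq_fintype_card, Fintype.card_units]
  exact absurd (Nat.le_of_dvd hk (h2 ▸ orderOf_dvd_of_pow_eq_one (Units.ext (by simpa using h1))))
    (by lia)

/-- The reduction of the Jacobi sum `J(ω⁻ᵃ, ω⁻¹)` for a Teichmüller character `ω`. -/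
theorem mk_jacobiSum_of_lift (hω : ∀ x, Ideal.Quotient.mk 𝔔 (ω x) = ι x) {a : ℕ} (ha : 1 ≤ a)
    (ha' : a + 1 < Fintype.card F - 1) :
    Ideal.Quotient.mk 𝔔 (jacobiSum (ω⁻¹ ^ a) ω⁻¹) = -((a + 1 : ℕ) : R ⧸ 𝔔) := by
  rw [← map_natCast ι, ← map_neg, ← sum_inv_pow_mul_one_sub_inv ha ha', jacobiSum, map_sum, map_sum]
  refine Finset.sum_congr rfl fun x _ => ?_
  rw [map_mul, MulChar.pow_apply' _ (by lia), MulChar.inv_apply', MulChar.inv_apply', map_pow, hω,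
    hω, map_mul, map_pow]

/-- **Stickelberger's bound.** Let `ω` be a Teichmüller character of a field `F` with `q ^ f`
elements with values in a domain, `𝔔` the prime of the lift, and let the values of `ψ` be
congruent to `1` modulo `l`. Then, at `𝔔`, the Gauss sum of `ω⁻ᵏ` is divisible by `l ^ s` for an
`s` that is at least the sum of the digits of `k` in base `q`. -/
theorem exists_pow_dvd_mul_gaussSum [IsDomain R] [𝔔.IsPrime]
    (hω : ∀ x, Ideal.Quotient.mk 𝔔 (ω x) = ι x) {q f : ℕ} (hq : 1 < q)
    (hcard : Fintype.card F = q ^ f) (hq𝔔 : ∀ k : ℕ, (k : R ⧸ 𝔔) = 0 → q ∣ k) (hF : 2 < q ^ f)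
    {ψ : AddChar F R} (hfrob : Function.Bijective fun x : F => x ^ q)
    (hψq : ∀ x, ψ (x ^ q) = ψ x) {l : R} (hl : ∀ x, l ∣ ψ x - 1) (k : ℕ) (hk : k < q ^ f - 1) :
    ∃ s, residueSum q f k * (q - 1) ≤ s * (q ^ f - 1) ∧
      ∃ u ∉ 𝔔, l ^ s ∣ u * gaussSum (ω⁻¹ ^ k) ψ := by
  -- Induction on `k`, removing the last digit when it is `0` and lowering it by `1` otherwise.
  have h1 : (1 : R) ∉ 𝔔 := fun h =>
    (inferInstance : 𝔔.IsPrime).ne_top ((Ideal.eq_top_iff_one _).2 h)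
  have hl1 : l ∣ gaussSum ω⁻¹ ψ := by
    have h0 : gaussSum ω⁻¹ ψ = ∑ x, ω⁻¹ x * (ψ x - 1) := by
      simp_rw [mul_sub, mul_one, Finset.sum_sub_distrib, gaussSum]
      rw [MulChar.sum_eq_zero_of_ne_one (χ := ω⁻¹), sub_zero]
      simpa using inv_pow_ne_one_of_lift hω one_pos (by lia)
    rw [h0]
    exact Finset.dvd_sum fun x _ => (hl x).mul_left _
  induction k using Nat.strong_induction_on with
  | _ k ih =>
  rcases Nat.eq_zero_or_pos k with rfl | hk0
  · exact ⟨0, by simp [residueSum_zero], 1, h1, by simp⟩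
  by_cases hqk : q ∣ k
  · obtain ⟨k', rfl⟩ := hqk
    have hk'0 : 0 < k' := Nat.pos_of_mul_pos_left hk0
    have hlt : k' < q * k' := (Nat.lt_mul_iff_one_lt_left hk'0).2 hq
    obtain ⟨s, hs, u, hu, hd⟩ := ih k' hlt (by lia)
    refine ⟨s, by rwa [residueSum_mul_left hq.le], u, hu, ?_⟩
    convert hd using 2
    -- the Frobenius `x ↦ x ^ q` permutes `F` and preserves `ψ`
    symm
    rw [gaussSum, gaussSum, ← (Equiv.ofBijective _ hfrob).sum_comp]
    refine Finset.sum_congr rfl fun x _ => ?_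
    rw [Equiv.ofBijective_apply, hψq, MulChar.pow_apply' _ (by lia), MulChar.pow_apply' _ (by lia),
      map_pow, ← pow_mul, mul_comm]
  · rcases eq_or_ne k 1 with rfl | hk1
    · refine ⟨1, ?_, 1, h1, by simpa using hl1⟩
      simpa [residueSum_zero] using residueSum_add_one_mul_le hq.le f 0
    · obtain ⟨a, rfl⟩ : ∃ a, k = a + 1 := ⟨k - 1, by lia⟩
      obtain ⟨s, hs, u, hu, hd⟩ := ih a (by lia) (by lia)
      refine ⟨s + 1, (residueSum_add_one_mul_le hq.le f a).trans (by rw [add_mul, one_mul]; gcongr),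
        u * jacobiSum (ω⁻¹ ^ a) ω⁻¹, ?_, ?_⟩
      · -- the Jacobi sum is congruent to `-k` modulo `𝔔`
        refine (inferInstance : 𝔔.IsPrime).mul_notMem hu fun h => hqk (hq𝔔 _ ?_)
        rw [← neg_eq_zero, ← mk_jacobiSum_of_lift hω (by lia) (by lia)]
        exact Ideal.Quotient.eq_zero_iff_mem.2 h
      · have hJ := jacobiSum_mul_nontrivial (χ := ω⁻¹ ^ a) (φ := ω⁻¹)
          (by rw [← pow_succ]; exact inv_pow_ne_one_of_lift hω hk0 (by lia)) ψ
        rw [pow_succ ω⁻¹, mul_assoc, mul_comm (jacobiSum _ _), hJ, ← mul_assoc, pow_succ]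
        exact mul_dvd_mul hd hl1

end Stickelberger

/-! ### Lifting roots of unity from a residue ring -/

section Lift

variable {R : Type*} [CommRing R] [IsDomain R] {𝔔 : Ideal R} [𝔔.IsPrime] {N : ℕ} {ν : R}

theorem IsPrimitiveRoot.mk_of_natCast_ne_zero (hν : IsPrimitiveRoot ν N)
    (hN : (N : R ⧸ 𝔔) ≠ 0) : IsPrimitiveRoot (Ideal.Quotient.mk 𝔔 ν) N := by
  have : NeZero (N : R ⧸ 𝔔) := ⟨hN⟩
  have hN0 : 0 < N := Nat.pos_of_ne_zero (by rintro rfl; simp at hN)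
  rw [← Polynomial.isRoot_cyclotomic_iff, ← Polynomial.map_cyclotomic N (Ideal.Quotient.mk 𝔔)]
  exact (hν.isRoot_cyclotomic hN0).map

theorem eq_of_mk_eq_of_pow_eq_one (hν : IsPrimitiveRoot ν N) (hN : (N : R ⧸ 𝔔) ≠ 0) {x y : R}
    (hx : x ^ N = 1) (hy : y ^ N = 1) (h : Ideal.Quotient.mk 𝔔 x = Ideal.Quotient.mk 𝔔 y) :
    x = y := by
  have hN0 : NeZero N := ⟨by rintro rfl; simp at hN⟩
  obtain ⟨i, hi, rfl⟩ := hν.eq_pow_of_pow_eq_one hx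
  obtain ⟨j, hj, rfl⟩ := hν.eq_pow_of_pow_eq_one hy
  rw [map_pow, map_pow] at h
  rw [(hν.mk_of_natCast_ne_zero hN).pow_inj hi hj h]

/-- A character with values in the `N`-th roots of unity of a residue ring lifts. -/
theorem exists_mulChar_lift {F : Type*} [CommMonoid F] (hν : IsPrimitiveRoot ν N)
    (hN : (N : R ⧸ 𝔔) ≠ 0) (θ : Fˣ →* (R ⧸ 𝔔)ˣ) (hθ : ∀ x, θ x ^ N = 1) :
    ∃ c : MulChar F R, c ^ N = 1 ∧ ∀ x : Fˣ, Ideal.Quotient.mk 𝔔 (c x) = θ x := by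
  classical
  have hN0 : NeZero N := ⟨by rintro rfl; simp at hN⟩
  let r := restrictRootsOfUnity (Ideal.Quotient.mk 𝔔) N
  have hr : Function.Bijective r := by
    refine ⟨fun x y hxy => ?_, fun y => ?_⟩
    · refine Subtype.ext (Units.ext (eq_of_mk_eq_of_pow_eq_one hν hN ?_ ?_ ?_))
      · exact (mem_rootsOfUnity' _ _).1 x.2
      · exact (mem_rootsOfUnity' _ _).1 y.2
      · exact congrArg (fun z : rootsOfUnity N (R ⧸ 𝔔) => ((z : (R ⧸ 𝔔)ˣ) : R ⧸ 𝔔)) hxy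
    · obtain ⟨i, hi, h⟩ := (hν.mk_of_natCast_ne_zero hN).eq_pow_of_pow_eq_one
        ((mem_rootsOfUnity' _ _).1 y.2)
      refine ⟨hν.toRootsOfUnity ^ i, Subtype.ext (Units.ext ?_)⟩
      rw [← h]
      simp [r]
  let e := MulEquiv.ofBijective r hr
  let θ' : Fˣ →* rootsOfUnity N (R ⧸ 𝔔) := θ.codRestrict _ fun x => by
    rw [mem_rootsOfUnity]; exact hθ x
  let c' : Fˣ →* Rˣ := (rootsOfUnity N R).subtype.comp (e.symm.toMonoidHom.comp θ')
  refine ⟨MulChar.ofUnitHom c', ?_, fun x => ?_⟩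
  · ext x
    rw [MulChar.pow_apply_coe, MulChar.ofUnitHom_coe, MulChar.one_apply_coe]
    exact (mem_rootsOfUnity' _ _).1 (e.symm (θ' x)).2
  · rw [MulChar.ofUnitHom_coe]
    have h : e (e.symm (θ' x)) = θ' x := e.apply_symm_apply _
    exact congrArg (fun z : rootsOfUnity N (R ⧸ 𝔔) => ((z : (R ⧸ 𝔔)ˣ) : R ⧸ 𝔔)) h

end Lift

/-! ### Descent of divisibility to an unramified prime -/

section Descent

theorem IsPrimitiveRoot.natCast_dvd_sub_one_pow {R : Type*} [CommRing R] [IsDomain R] {q : ℕ}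
    (hq : q.Prime) {ξ : R} (hξ : IsPrimitiveRoot ξ q) : (q : R) ∣ (ξ - 1) ^ (q - 1) := by
  obtain ⟨n, rfl⟩ := Nat.exists_eq_add_of_le' hq.one_le
  have h := hξ.prod_one_sub_pow_eq_order
  rw [Nat.cast_add_one, ← h, Nat.add_sub_cancel, ← neg_sub, neg_pow]
  refine Dvd.dvd.mul_left ?_ _
  rw [show (1 - ξ) ^ n = ∏ _i ∈ Finset.range n, (1 - ξ) by simp]
  refine Finset.prod_dvd_prod_of_dvd _ _ fun i hi => ?_
  have := (hξ.associated_sub_one_pow_sub_one_of_coprime (j := i + 1) ?_).dvd'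
  · rwa [← neg_dvd, neg_sub, ← dvd_neg, neg_sub] at this
  · exact (Nat.coprime_of_lt_prime (by lia) (by simpa using hi) hq).symm

/-- Let `𝔮` be a prime of a Dedekind domain dividing `c` exactly once and `𝔔` a prime above it.
An element of the Dedekind domain that is divisible by `c ^ e` locally at `𝔔` lies in `𝔮 ^ e`. -/
theorem mem_pow_of_pow_dvd_mul {D R : Type*} [CommRing D] [IsDedekindDomain D] [CommRing R]
    [IsDomain R] [Algebra D R] [FaithfulSMul D R] {𝔮 : Ideal D} [𝔮.IsPrime] {c : D}
    (hc0 : c ≠ 0) (hc : c ∈ 𝔮) (hc2 : c ∉ 𝔮 ^ 2) {𝔔 : Ideal R} [𝔔.IsPrime] [𝔔.LiesOver 𝔮]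
    {e : ℕ} {x : D}
    {u : R} (hu : u ∉ 𝔔) (h : algebraMap D R c ^ e ∣ u * algebraMap D R x) : x ∈ 𝔮 ^ e := by
  obtain ⟨b, hb⟩ : 𝔮 ∣ Ideal.span {c} := by
    rwa [Ideal.dvd_span_singleton]
  -- `y` clears the part of `c` prime to `𝔮`: multiplication by it sends `𝔮` into `(c)`
  obtain ⟨y, hyb, hy⟩ : ∃ y ∈ b, y ∉ 𝔮 := by
    by_contra! h'
    apply hc2
    rw [← Ideal.dvd_span_singleton, hb, sq]
    exact mul_dvd_mul_left _ (Ideal.dvd_iff_le.2 h')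
  have hover : ∀ z, algebraMap D R z ∈ 𝔔 ↔ z ∈ 𝔮 := fun z => (Ideal.mem_of_liesOver 𝔔 𝔮 z).symm
  induction e generalizing x u with
  | zero => simp
  | succ e ih =>
    have hx : x ∈ 𝔮 := by
      rw [← hover]
      refine ((inferInstance : 𝔔.IsPrime).mem_or_mem (Ideal.mem_of_dvd _ h ?_)).resolve_left hu
      rw [pow_succ]
      exact Ideal.mul_mem_left _ _ ((hover c).2 hc)
    obtain ⟨z, hz⟩ : c ∣ x * y := by
      rw [← Ideal.mem_span_singleton, hb]
      exact Ideal.mul_mem_mul hx hyb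
    have hzx : z ∈ 𝔮 ^ e := by
      refine ih hu ?_
      have h1 : algebraMap D R c ≠ 0 := by simpa using hc0
      rw [← mul_dvd_mul_iff_left h1, ← pow_succ']
      refine (h.mul_right (algebraMap D R y)).trans (dvd_of_eq ?_)
      rw [mul_assoc, ← map_mul, hz, map_mul]
      ring
    have hxy : y * x ∈ 𝔮 ^ (e + 1) := by
      rw [mul_comm, hz, pow_succ']
      exact Ideal.mul_mem_mul hc hzx
    exact (Ideal.IsPrime.mul_mem_pow 𝔮 hxy).resolve_left hy

end Descent

namespace KummerStickelberger

open NumberField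

/-! ### The residue field and its additive character -/

section Residue

variable {K : Type*} [Field K] {q : ℕ} [hq : Fact q.Prime] {𝔮 : Ideal (𝓞 K)}
  [𝔮.IsPrime] [𝔮.LiesOver (Ideal.span {(q : ℤ)})]

theorem isMaximal_span_natCast (q : ℕ) [hq : Fact q.Prime] :
    (Ideal.span {(q : ℤ)}).IsMaximal := by
  have := (Ideal.span_singleton_prime (by exact_mod_cast hq.out.ne_zero)).2
    (Nat.prime_iff_prime_int.1 hq.out)
  exact this.isMaximal (by simpa using hq.out.ne_zero)

include hq in
theorem isMaximal_of_liesOver : 𝔮.IsMaximal :=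
  have := isMaximal_span_natCast q
  Ideal.IsMaximal.of_liesOver_isMaximal 𝔮 (Ideal.span {(q : ℤ)})

omit hq [𝔮.IsPrime] in
theorem natCast_mem_of_liesOver : (q : 𝓞 K) ∈ 𝔮 := by
  have h : (q : ℤ) ∈ Ideal.span {(q : ℤ)} := Ideal.mem_span_singleton_self _
  rw [Ideal.mem_of_liesOver 𝔮 (Ideal.span {(q : ℤ)})] at h
  simpa using h

theorem charP_quotient : CharP (𝓞 K ⧸ 𝔮) q := by
  have h : ((q : ℕ) : 𝓞 K ⧸ 𝔮) = 0 := by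
    rw [← map_natCast (Ideal.Quotient.mk 𝔮), Ideal.Quotient.eq_zero_iff_mem]
    exact natCast_mem_of_liesOver
  have := (isMaximal_of_liesOver (q := q) (𝔮 := 𝔮)).ne_top
  have : Nontrivial (𝓞 K ⧸ 𝔮) := Ideal.Quotient.nontrivial_iff.2 this
  exact (CharP.charP_iff_prime_eq_zero hq.out).2 h

/-- `residueTrace` as a homomorphism of additive groups. -/
noncomputable def residueTraceHom (q : ℕ) (𝔮 : Ideal (𝓞 K)) [𝔮.LiesOver (Ideal.span {(q : ℤ)})] :
    (𝓞 K ⧸ 𝔮) →+ ZMod q :=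
  (Int.quotientSpanNatEquivZMod q : _ →+ ZMod q).comp
    (Algebra.trace (ℤ ⧸ Ideal.span {(q : ℤ)}) (𝓞 K ⧸ 𝔮)).toAddMonoidHom

theorem residueTrace_pow [Finite (𝓞 K ⧸ 𝔮)] (x : 𝓞 K ⧸ 𝔮) :
    residueTrace q 𝔮 (x ^ q) = residueTrace q 𝔮 x := by
  have := isMaximal_span_natCast q
  have : 𝔮.IsMaximal := isMaximal_of_liesOver (q := q)
  let := Ideal.Quotient.field (Ideal.span {(q : ℤ)})
  let := Ideal.Quotient.field 𝔮
  let : Fintype (ℤ ⧸ Ideal.span {(q : ℤ)}) :=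
    have : NeZero q := ⟨hq.out.ne_zero⟩
    Fintype.ofEquiv _ (Int.quotientSpanNatEquivZMod q).symm.toEquiv
  have hc : Fintype.card (ℤ ⧸ Ideal.span {(q : ℤ)}) = q := by
    rw [← Nat.card_eq_fintype_card, Nat.card_congr (Int.quotientSpanNatEquivZMod q).toEquiv,
      Nat.card_zmod]
  have h := Algebra.trace_eq_of_algEquiv
    (FiniteField.frobeniusAlgEquivOfAlgebraic (ℤ ⧸ Ideal.span {(q : ℤ)}) (𝓞 K ⧸ 𝔮)) x
  rw [FiniteField.coe_frobeniusAlgEquivOfAlgebraic, hc] at h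
  rw [residueTrace, h, residueTrace]

theorem exists_residueTrace_ne_zero [Finite (𝓞 K ⧸ 𝔮)] : ∃ x, residueTrace q 𝔮 x ≠ 0 := by
  have := isMaximal_span_natCast q
  have : 𝔮.IsMaximal := isMaximal_of_liesOver (q := q)
  let := Ideal.Quotient.field (Ideal.span {(q : ℤ)})
  let := Ideal.Quotient.field 𝔮
  let : Fintype (ℤ ⧸ Ideal.span {(q : ℤ)}) :=
    have : NeZero q := ⟨hq.out.ne_zero⟩
    Fintype.ofEquiv _ (Int.quotientSpanNatEquivZMod q).symm.toEquiv
  obtain ⟨x, hx⟩ := Algebra.trace_surjective (ℤ ⧸ Ideal.span {(q : ℤ)}) (𝓞 K ⧸ 𝔮) 1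
  refine ⟨x, ?_⟩
  rw [residueTrace, hx, map_one]
  exact one_ne_zero

/-- The additive character `x ↦ ξ ^ Tr x` of the residue field, for a `q`-th root of unity `ξ`. -/
noncomputable def residueAddChar (𝔮 : Ideal (𝓞 K)) [𝔮.LiesOver (Ideal.span {(q : ℤ)})]
    {R : Type*} [CommRing R] {ξ : R} (hξ : ξ ^ q = 1) : AddChar (𝓞 K ⧸ 𝔮) R :=
  have : NeZero q := ⟨hq.out.ne_zero⟩
  (AddChar.zmodChar q hξ).compAddMonoidHom (residueTraceHom q 𝔮)

omit [𝔮.IsPrime] in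
theorem residueAddChar_apply {R : Type*} [CommRing R] {ξ : R} (hξ : ξ ^ q = 1) (x : 𝓞 K ⧸ 𝔮) :
    residueAddChar 𝔮 hξ x = ξ ^ (residueTrace q 𝔮 x).val := rfl

theorem residueAddChar_ne_one [Finite (𝓞 K ⧸ 𝔮)] {R : Type*} [CommRing R] {ξ : R}
    (hξ : IsPrimitiveRoot ξ q) : residueAddChar 𝔮 hξ.pow_eq_one ≠ 1 := by
  have : NeZero q := ⟨hq.out.ne_zero⟩
  obtain ⟨x, hx⟩ := exists_residueTrace_ne_zero (q := q) (𝔮 := 𝔮)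
  refine AddChar.ne_one_iff.2 ⟨x, fun h => hx ?_⟩
  rw [residueAddChar_apply, hξ.pow_eq_one_iff_dvd] at h
  exact (ZMod.val_eq_zero _).1 (Nat.eq_zero_of_dvd_of_lt h (ZMod.val_lt _))

end Residue

/-! ### The `p`-th power of a Gauss sum of order `p` -/

section GaussPow

variable {F : Type*} [CommRing F] [Fintype F]

/-- The `p`-th power of the Gauss sum of a character of order `p`, written in terms of Jacobi sums;
it lies in the ring of values of the character. -/
noncomputable def gaussPow {R : Type*} [CommRing R] (p : ℕ) (χ : MulChar F R) : R :=
  χ (-1) * Fintype.card F * ∏ i ∈ Finset.Ico 1 (p - 1), jacobiSum χ (χ ^ i)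

theorem gaussPow_ringHomComp {R R' : Type*} [CommRing R] [CommRing R'] (p : ℕ) (χ : MulChar F R)
    (φ : R →+* R') : gaussPow p (χ.ringHomComp φ) = φ (gaussPow p χ) := by
  simp only [gaussPow, map_mul, map_prod, map_natCast, MulChar.ringHomComp_pow,
    jacobiSum_ringHomComp, MulChar.ringHomComp_apply]

theorem gaussSum_pow_eq_gaussPow {F : Type*} [Field F] [Fintype F] {R : Type*} [CommRing R]
    [IsDomain R] {p : ℕ} [hp : Fact p.Prime] {χ : MulChar F R} (hχ : χ ≠ 1) (hχp : χ ^ p = 1)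
    {ψ : AddChar F R} (hψ : ψ ≠ 1) : gaussSum χ ψ ^ p = gaussPow p χ := by
  have h : orderOf χ = p := orderOf_eq_prime hχp hχ
  rw [gaussPow, ← h]
  exact gaussSum_pow_eq_prod_jacobiSum (h ▸ hp.out.two_le) (AddChar.IsPrimitive.of_ne_one hψ)

omit [Fintype F] in
theorem apply_neg_one_of_pow_eq_one {R : Type*} [CommRing R]
    {p : ℕ} (hp : Odd p) {χ : MulChar F R} (hχp : χ ^ p = 1) : χ (-1) = 1 := by
  have h1 : χ (-1) ^ p = 1 := by
    rw [← Units.coe_neg_one, ← MulChar.pow_apply_coe, hχp, MulChar.one_apply_coe]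
  rw [← map_pow, hp.neg_one_pow] at h1
  exact h1

end GaussPow

/-! ### The power residue character -/

section Character

variable {K : Type*} [Field K] [NumberField K] {p : ℕ} [hp : Fact p.Prime] {ζ : K}
  {q : ℕ} [hq : Fact q.Prime] {𝔮 : Ideal (𝓞 K)} [𝔮.IsPrime] [𝔮.LiesOver (Ideal.span {(q : ℤ)})]

omit [NumberField K] in
theorem natCast_quotient_ne_zero (hqp : q ≠ p) : ((p : ℕ) : 𝓞 K ⧸ 𝔮) ≠ 0 := by
  have := charP_quotient (q := q) (𝔮 := 𝔮)
  rw [Ne, CharP.cast_eq_zero_iff (𝓞 K ⧸ 𝔮) q]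
  exact fun h => hqp ((Nat.prime_dvd_prime_iff_eq hq.out hp.out).1 h)

theorem natCast_notMem_sq [IsCyclotomicExtension {p} ℚ K] (hqp : q ≠ p) :
    (q : 𝓞 K) ∉ 𝔮 ^ 2 := by
  intro h
  have h1 : Ideal.ramificationIdx 𝔮 ℤ = 1 :=
    IsCyclotomicExtension.Rat.ramificationIdx_eq_of_not_dvd (m := p) q K 𝔮
      (fun h => hqp ((Nat.prime_dvd_prime_iff_eq hq.out hp.out).1 h))
  have h2 : Ideal.ramificationIdx' (Ideal.span {(q : ℤ)}) 𝔮 = 1 := by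
    rw [Ideal.ramificationIdx'_eq_ramificationIdx, h1]
    simpa using hq.out.ne_zero
  refine absurd h2 ((Ideal.ramificationIdx'_ne_one_iff ?_).2 ?_)
  · rw [Ideal.map_span, Set.image_singleton, Ideal.span_singleton_le_iff_mem]
    simpa using natCast_mem_of_liesOver
  · rw [Ideal.map_span, Set.image_singleton, Ideal.span_singleton_le_iff_mem]
    simpa using h

/-- The `p`-th roots of unity inject into the residue field, whence `p` divides `#F - 1`. -/
theorem dvd_card_quotient_sub_one (hζ : IsPrimitiveRoot ζ p) (h𝔮 : 𝔮 ≠ ⊥) (hqp : q ≠ p) :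
    p ∣ Nat.card (𝓞 K ⧸ 𝔮) - 1 := by
  have : 𝔮.IsMaximal := isMaximal_of_liesOver (q := q)
  let := Ideal.Quotient.field 𝔮
  have : Finite (𝓞 K ⧸ 𝔮) := Ideal.finiteQuotientOfFreeOfNeBot 𝔮 h𝔮
  let := Fintype.ofFinite (𝓞 K ⧸ 𝔮)
  have h := hζ.toInteger_isPrimitiveRoot.mk_of_natCast_ne_zero (𝔔 := 𝔮)
    (natCast_quotient_ne_zero (q := q) hqp)
  rw [h.eq_orderOf, Nat.card_eq_fintype_card]
  refine orderOf_dvd_of_pow_eq_one (FiniteField.pow_card_sub_one_eq_one _ ?_)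
  exact h.ne_zero hp.out.ne_zero

/-- The power residue symbol is a multiplicative character. -/
theorem exists_mulChar_powerResidue (hζ : IsPrimitiveRoot ζ p) (h𝔮 : 𝔮 ≠ ⊥) (hqp : q ≠ p) :
    ∃ ρ : MulChar (𝓞 K ⧸ 𝔮) (𝓞 K), ρ ^ p = 1 ∧ ρ ≠ 1 ∧
      (∀ x : (𝓞 K ⧸ 𝔮)ˣ, Ideal.Quotient.mk 𝔮 (ρ x) = x ^ ((Nat.card (𝓞 K ⧸ 𝔮) - 1) / p)) ∧
      ∀ x, ρ x = powerResidue p 𝔮 x := by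
  have : 𝔮.IsMaximal := isMaximal_of_liesOver (q := q)
  let := Ideal.Quotient.field 𝔮
  have : Finite (𝓞 K ⧸ 𝔮) := Ideal.finiteQuotientOfFreeOfNeBot 𝔮 h𝔮
  let := Fintype.ofFinite (𝓞 K ⧸ 𝔮)
  classical
  have hdvd := dvd_card_quotient_sub_one hζ h𝔮 hqp
  have hp0 := natCast_quotient_ne_zero (q := q) (𝔮 := 𝔮) hqp
  set N := (Nat.card (𝓞 K ⧸ 𝔮) - 1) / p with hN
  have hNp : N * p = Nat.card (𝓞 K ⧸ 𝔮) - 1 := Nat.div_mul_cancel hdvd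
  have hcard : Nat.card (𝓞 K ⧸ 𝔮)ˣ = Nat.card (𝓞 K ⧸ 𝔮) - 1 := by
    rw [Nat.card_eq_fintype_card, Nat.card_eq_fintype_card, Fintype.card_units]
  obtain ⟨ρ, hρp, hρ⟩ := exists_mulChar_lift hζ.toInteger_isPrimitiveRoot hp0
    (powMonoidHom N : (𝓞 K ⧸ 𝔮)ˣ →* _) fun x => by
      rw [powMonoidHom_apply, ← pow_mul, hNp, ← hcard]
      exact pow_card_eq_one'
  replace hρ : ∀ x : (𝓞 K ⧸ 𝔮)ˣ, Ideal.Quotient.mk 𝔮 (ρ x) = x ^ N := fun x => by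
    rw [hρ, powMonoidHom_apply, Units.val_pow_eq_pow_val]
  refine ⟨ρ, hρp, ?_, hρ, fun x => ?_⟩
  · rintro rfl
    obtain ⟨g, hg⟩ := IsCyclic.exists_generator (α := (𝓞 K ⧸ 𝔮)ˣ)
    have h1 := hρ g
    rw [MulChar.one_apply_coe, map_one, ← Units.val_pow_eq_pow_val, eq_comm, Units.val_eq_one] at h1
    have h2 := orderOf_dvd_of_pow_eq_one h1
    rw [orderOf_eq_card_of_forall_mem_zpowers hg, hcard, ← hNp] at h2
    have hN0 : 0 < N := by
      refine Nat.pos_of_ne_zero fun h => ?_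
      rw [h, zero_mul, ← hcard] at hNp
      exact Nat.card_pos.ne hNp
    have := Nat.le_of_dvd hN0 h2
    have := hp.out.two_le
    nlinarith
  · by_cases hx : x = 0
    · rw [hx, powerResidue, dif_neg (by simp)]
      exact MulChar.map_zero ρ
    · lift x to (𝓞 K ⧸ 𝔮)ˣ using isUnit_iff_ne_zero.2 hx
      have hρx : ρ x ^ p = 1 := by rw [← MulChar.pow_apply_coe, hρp, MulChar.one_apply_coe]
      have hex : (x : 𝓞 K ⧸ 𝔮) ≠ 0 ∧ ∃ ξ : 𝓞 K, ξ ^ p = 1 ∧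
          (x : 𝓞 K ⧸ 𝔮) ^ ((Nat.card (𝓞 K ⧸ 𝔮) - 1) / p) = Ideal.Quotient.mk 𝔮 ξ :=
        ⟨hx, ρ x, hρx, (hρ x).symm⟩
      rw [powerResidue, dif_pos hex]
      exact eq_of_mk_eq_of_pow_eq_one hζ.toInteger_isPrimitiveRoot hp0 hρx hex.2.choose_spec.1
        ((hρ x).trans hex.2.choose_spec.2)

omit [NumberField K] hp in
/-- `gauss` is the Gauss sum of the inverse of the power residue character. -/
theorem gauss_eq_gaussSum [Fintype (𝓞 K ⧸ 𝔮)] {ρ : MulChar (𝓞 K ⧸ 𝔮) (𝓞 K)}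
    (hρ : ∀ x, ρ x = powerResidue p 𝔮 x) {L : Type*} [Field L] [Algebra K L] {ζq : L}
    (hζq : ζq ^ q = 1) :
    gauss p q 𝔮 ζq = gaussSum (ρ⁻¹.ringHomComp ((algebraMap K L).comp (algebraMap (𝓞 K) K)))
      (residueAddChar 𝔮 hζq) := by
  have : 𝔮.IsMaximal := isMaximal_of_liesOver (q := q)
  let := Ideal.Quotient.field 𝔮
  rw [gauss, finsum_eq_sum_of_fintype, gaussSum]
  refine Finset.sum_congr rfl fun x _ => ?_
  rw [residueAddChar_apply, MulChar.ringHomComp_apply, RingHom.comp_apply, residueChar, ← hρ]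
  congr 2
  by_cases hx : x = 0
  · rw [hx, MulChar.map_zero ρ, MulChar.map_zero]
    simp
  · refine inv_eq_of_mul_eq_one_left ?_
    change algebraMap (𝓞 K) K _ * algebraMap (𝓞 K) K _ = 1
    rw [← map_mul, ← MulChar.mul_apply, inv_mul_cancel, MulChar.one_apply
      (isUnit_iff_ne_zero.2 hx), map_one]

end Character

/-! ### Stickelberger's bound in the cyclotomic field -/

section Bound

theorem residueSum_mul_div {p : ℕ} (q f t : ℕ) (hp : p ∣ q ^ f - 1) :
    residueSum q f (t * ((q ^ f - 1) / p)) =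
      (∑ l ∈ Finset.range f, q ^ l * t % p) * ((q ^ f - 1) / p) := by
  rw [residueSum, Finset.sum_mul]
  refine Finset.sum_congr rfl fun l _ => ?_
  conv_lhs => rw [← mul_assoc]; enter [2]; rw [← Nat.mul_div_cancel' hp]
  rw [Nat.mul_mod_mul_right]

variable {K : Type*} [Field K] [NumberField K] {p : ℕ} [hp : Fact p.Prime] {ζ : K}
  {q : ℕ} [hq : Fact q.Prime] {𝔮 : Ideal (𝓞 K)} [𝔮.IsPrime] [𝔮.LiesOver (Ideal.span {(q : ℤ)})]

/-- The `𝔮`-adic valuation of the `p`-th power of the Gauss sum of `ρ⁻ᵗ` is at least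
`∑_{l < f} (q ^ l t mod p)`. The bound is proved over the ring of algebraic integers, which
contains all the roots of unity involved. -/
theorem gaussPow_mem_pow [IsCyclotomicExtension {p} ℚ K] (hζ : IsPrimitiveRoot ζ p) (hp2 : p ≠ 2)
    (h𝔮 : 𝔮 ≠ ⊥) (hqp : q ≠ p) [Fintype (𝓞 K ⧸ 𝔮)] {f : ℕ} (hf : Nat.card (𝓞 K ⧸ 𝔮) = q ^ f)
    {ρ : MulChar (𝓞 K ⧸ 𝔮) (𝓞 K)} (hρp : ρ ^ p = 1) (hρ1 : ρ ≠ 1)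
    (hρ : ∀ x : (𝓞 K ⧸ 𝔮)ˣ,
      Ideal.Quotient.mk 𝔮 (ρ x) = x ^ ((Nat.card (𝓞 K ⧸ 𝔮) - 1) / p))
    {t : ℕ} (ht0 : 0 < t) (htp : t < p) :
    gaussPow p (ρ⁻¹ ^ t) ∈ 𝔮 ^ (∑ l ∈ Finset.range f, q ^ l * t % p) := by
  classical
  have : 𝔮.IsMaximal := isMaximal_of_liesOver (q := q)
  let := Ideal.Quotient.field 𝔮
  have hdvd := dvd_card_quotient_sub_one hζ h𝔮 hqp
  have hcard : Fintype.card (𝓞 K ⧸ 𝔮) = q ^ f := by rw [← Nat.card_eq_fintype_card, hf]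
  rw [hf] at hdvd hρ
  have h1lt : 1 < q ^ f := hcard ▸ Fintype.one_lt_card
  set N := (q ^ f - 1) / p with hN
  have hNp : N * p = q ^ f - 1 := Nat.div_mul_cancel hdvd
  have hN0 : 0 < N := Nat.pos_of_ne_zero fun h => by rw [h] at hNp; lia
  have hp3 : 3 ≤ p := by have := hp.out.two_le; lia
  have hq1 := hq.out.one_lt
  -- the ring of algebraic integers and a prime above `𝔮`
  let Ω := AlgebraicClosure K
  let R := integralClosure (𝓞 K) Ω
  obtain ⟨𝔔, h𝔔max, h𝔔⟩ := Ideal.exists_maximal_ideal_liesOver_of_isIntegral (S := R) 𝔮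
  have hroot : ∀ n : ℕ, 0 < n → ∃ ν : R, IsPrimitiveRoot ν n := fun n hn => by
    have : NeZero n := ⟨hn.ne'⟩
    obtain ⟨ν, hν⟩ := HasEnoughRootsOfUnity.exists_primitiveRoot Ω n
    exact ⟨⟨ν, (hν.isIntegral hn).tower_top⟩,
      IsPrimitiveRoot.of_map_of_injective (f := R.val) hν Subtype.val_injective⟩
  let ι : 𝓞 K ⧸ 𝔮 →+* R ⧸ 𝔔 := algebraMap (𝓞 K ⧸ 𝔮) (R ⧸ 𝔔)
  have hι : ∀ x : 𝓞 K, ι (Ideal.Quotient.mk 𝔮 x) = Ideal.Quotient.mk 𝔔 (algebraMap (𝓞 K) R x) :=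
    fun x => rfl
  have hch : CharP (𝓞 K ⧸ 𝔮) q := charP_quotient
  have hch' : CharP (R ⧸ 𝔔) q := charP_of_injective_ringHom ι.injective q
  have hm1 : ((q ^ f - 1 : ℕ) : R ⧸ 𝔔) ≠ 0 := by
    rw [Ne, CharP.cast_eq_zero_iff (R ⧸ 𝔔) q]
    intro h
    have hf0 : f ≠ 0 := by rintro rfl; simp at h1lt
    have h' := (Nat.dvd_sub_iff_right h1lt.le (dvd_pow_self q hf0)).1 h
    exact hq.out.one_lt.not_ge (Nat.le_of_dvd one_pos h')
  -- the Teichmüller character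
  obtain ⟨ν, hν⟩ := hroot (q ^ f - 1) (by lia)
  obtain ⟨ω, hω1, hω⟩ := exists_mulChar_lift hν hm1 (Units.map (ι : 𝓞 K ⧸ 𝔮 →* R ⧸ 𝔔)) fun x => by
    rw [← map_pow, ← hcard, ← Fintype.card_units, pow_card_eq_one, map_one]
  have hω' : ∀ x, Ideal.Quotient.mk 𝔔 (ω x) = ι x := fun x => by
    by_cases hx : x = 0
    · rw [hx, MulChar.map_zero ω, map_zero, map_zero]
    · lift x to (𝓞 K ⧸ 𝔮)ˣ using isUnit_iff_ne_zero.2 hx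
      exact hω x
  have hρω : ρ.ringHomComp (algebraMap (𝓞 K) R) = ω ^ N := by
    refine MulChar.ext fun x => ?_
    refine eq_of_mk_eq_of_pow_eq_one hν hm1 ?_ ?_ ?_
    · rw [MulChar.ringHomComp_apply, ← map_pow, ← hNp, mul_comm, pow_mul, ← MulChar.pow_apply_coe,
        hρp, MulChar.one_apply_coe, one_pow, map_one]
    · rw [← MulChar.pow_apply_coe, pow_right_comm, hω1, one_pow, MulChar.one_apply_coe]
    · rw [MulChar.ringHomComp_apply, ← hι, hρ, MulChar.pow_apply_coe, map_pow, map_pow, hω']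
  have hχ : (ρ⁻¹ ^ t).ringHomComp (algebraMap (𝓞 K) R) = ω⁻¹ ^ (t * N) := by
    rw [← MulChar.ringHomComp_pow, ← MulChar.ringHomComp_inv, hρω, mul_comm t, pow_mul, inv_pow ω]
  -- the Gauss sums over the ring of algebraic integers
  obtain ⟨ξ, hξ⟩ := hroot q hq.out.pos
  have hfrob : Function.Bijective fun x : 𝓞 K ⧸ 𝔮 => x ^ q := by
    have := ExpChar.prime (R := 𝓞 K ⧸ 𝔮) hq.out
    exact bijective_frobenius (𝓞 K ⧸ 𝔮) q
  obtain ⟨s, hs, u, hu, hdiv⟩ := exists_pow_dvd_mul_gaussSum hω' hq1 hcard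
    (fun k => (CharP.cast_eq_zero_iff (R ⧸ 𝔔) q k).1)
    (by have := Nat.le_of_dvd (by lia) hdvd; lia) (ψ := residueAddChar 𝔮 hξ.pow_eq_one) hfrob
    (fun x => by rw [residueAddChar_apply, residueAddChar_apply, residueTrace_pow])
    (l := ξ - 1) (fun x => by
      rw [residueAddChar_apply]
      simpa using sub_dvd_pow_sub_pow ξ 1 _) (t * N)
    (by rw [← hNp, mul_comm N]; gcongr)
  set e := ∑ l ∈ Finset.range f, q ^ l * t % p with he
  have hes : (q - 1) * e ≤ s * p := by
    rw [hN, residueSum_mul_div q f t hdvd, ← he, ← hN, ← hNp] at hs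
    refine Nat.le_of_mul_le_mul_left (c := N) ?_ hN0
    linarith
  have hpow : (q : R) ^ e ∣ u ^ p * algebraMap (𝓞 K) R (gaussPow p (ρ⁻¹ ^ t)) := by
    rw [← gaussPow_ringHomComp, ← gaussSum_pow_eq_gaussPow (ψ := residueAddChar 𝔮 hξ.pow_eq_one)
      _ _ (residueAddChar_ne_one hξ), hχ, ← mul_pow]
    · refine (pow_dvd_pow_of_dvd (hξ.natCast_dvd_sub_one_pow hq.out) e).trans ?_
      rw [← pow_mul]
      refine (pow_dvd_pow _ hes).trans ?_
      rw [pow_mul]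
      exact pow_dvd_pow_of_dvd hdiv p
    · rw [MulChar.ringHomComp_ne_one_iff (FaithfulSMul.algebraMap_injective _ _)]
      refine pow_ne_one_of_lt_orderOf ht0.ne' ?_
      rwa [orderOf_inv, orderOf_eq_prime hρp hρ1]
    · rw [hχ, ← pow_mul, mul_assoc, hNp, mul_comm, pow_mul, inv_pow, hω1, inv_one, one_pow]
  refine mem_pow_of_pow_dvd_mul (c := (q : 𝓞 K)) (by exact_mod_cast hq.out.ne_zero)
    natCast_mem_of_liesOver (natCast_notMem_sq (p := p) hqp) (R := R) (𝔔 := 𝔔)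
    (u := u ^ p) (fun h => hu (h𝔔max.isPrime.mem_of_pow_mem p h)) ?_
  rwa [map_natCast]

end Bound

/-! ### Exponents in the group ring -/

section GaloisPower

variable {K : Type*} [Field K] [CharZero K]

theorem galPow_single (x : K) (g : K ≃ₐ[ℚ] K) (n : ℤ) :
    galPow x (MonoidAlgebra.single g n) = g x ^ n := by
  rw [galPow, MonoidAlgebra.coeff_single, Finsupp.prod_single_index (zpow_zero _)]

theorem galPow_zero (x : K) : galPow x 0 = 1 := by
  rw [galPow, MonoidAlgebra.coeff_zero, Finsupp.prod_zero_index]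

theorem galPow_add {x : K} (hx : x ≠ 0) (θ θ' : MonoidAlgebra ℤ (K ≃ₐ[ℚ] K)) :
    galPow x (θ + θ') = galPow x θ * galPow x θ' := by
  rw [galPow, MonoidAlgebra.coeff_add]
  exact Finsupp.prod_add_index' (fun _ => zpow_zero _)
    fun g _ _ => zpow_add₀ (by simpa using hx) _ _

theorem galPow_grp (x : K) (g : K ≃ₐ[ℚ] K) : galPow x (grp g) = g x := by
  rw [grp, galPow_single, zpow_one]

theorem galPow_one (x : K) : galPow x 1 = x := by
  rw [MonoidAlgebra.one_def, galPow_single, zpow_one, AlgEquiv.one_apply]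

theorem galPow_neg {x : K} (hx : x ≠ 0) (θ : MonoidAlgebra ℤ (K ≃ₐ[ℚ] K)) :
    galPow x (-θ) = (galPow x θ)⁻¹ := by
  refine eq_inv_of_mul_eq_one_left ?_
  rw [← galPow_add hx, neg_add_cancel, galPow_zero]

theorem galPow_sub {x : K} (hx : x ≠ 0) (θ θ' : MonoidAlgebra ℤ (K ≃ₐ[ℚ] K)) :
    galPow x (θ - θ') = galPow x θ / galPow x θ' := by
  rw [sub_eq_add_neg, galPow_add hx, galPow_neg hx, div_eq_mul_inv]

theorem galPow_ne_zero {x : K} (hx : x ≠ 0) (θ : MonoidAlgebra ℤ (K ≃ₐ[ℚ] K)) :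
    galPow x θ ≠ 0 :=
  Finset.prod_ne_zero_iff.2 fun g _ => zpow_ne_zero _ (by simpa using hx)

theorem galPow_mul_left (x y : K) (θ : MonoidAlgebra ℤ (K ≃ₐ[ℚ] K)) :
    galPow (x * y) θ = galPow x θ * galPow y θ := by
  simp only [galPow, Finsupp.prod, map_mul, mul_zpow, Finset.prod_mul_distrib]

theorem galPow_pow (x : K) (n : ℕ) (θ : MonoidAlgebra ℤ (K ≃ₐ[ℚ] K)) :
    galPow (x ^ n) θ = galPow x θ ^ n := by
  induction n with
  | zero => simp [galPow, Finsupp.prod]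
  | succ n ih => rw [pow_succ, galPow_mul_left, ih, pow_succ]

theorem galPow_natCast_smul {x : K} (hx : x ≠ 0) (n : ℕ) (θ : MonoidAlgebra ℤ (K ≃ₐ[ℚ] K)) :
    galPow x ((n : ℤ) • θ) = galPow x θ ^ n := by
  induction n with
  | zero => simp [galPow_zero]
  | succ n ih => rw [Nat.cast_add_one, add_smul, one_smul, galPow_add hx, ih, pow_succ]

theorem galPow_sum {x : K} (hx : x ≠ 0) {ι : Type*} (s : Finset ι)
    (θ : ι → MonoidAlgebra ℤ (K ≃ₐ[ℚ] K)) : galPow x (∑ i ∈ s, θ i) = ∏ i ∈ s, galPow x (θ i) := by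
  classical
  induction s using Finset.induction_on with
  | empty => simp [galPow_zero]
  | insert a s ha ih => rw [Finset.sum_insert ha, Finset.prod_insert ha, galPow_add hx, ih]

theorem grp_pow (g : K ≃ₐ[ℚ] K) (n : ℕ) : grp g ^ n = grp (g ^ n) := by
  rw [grp, grp, MonoidAlgebra.single_pow, one_pow]

theorem galPow_mul {x : K} (hx : x ≠ 0) (θ θ' : MonoidAlgebra ℤ (K ≃ₐ[ℚ] K)) :
    galPow x (θ * θ') = galPow (galPow x θ') θ := by
  induction θ using MonoidAlgebra.induction_linear with
  | zero => rw [zero_mul, galPow_zero, galPow_zero]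
  | add θ₁ θ₂ h₁ h₂ =>
    rw [add_mul, galPow_add hx, h₁, h₂, galPow_add (galPow_ne_zero hx _)]
  | single g n =>
    induction θ' using MonoidAlgebra.induction_linear with
    | zero => rw [mul_zero, galPow_zero, galPow_single, map_one, one_zpow]
    | add θ₁ θ₂ h₁ h₂ => rw [mul_add, galPow_add hx, h₁, h₂, galPow_add hx, galPow_mul_left]
    | single h m =>
      rw [MonoidAlgebra.single_mul_single, galPow_single, galPow_single, galPow_single, map_zpow₀,
        ← zpow_mul, mul_comm m, AlgEquiv.mul_apply]

theorem galPow_sign {ε : K} (hε : ε = 1 ∨ ε = -1) (θ : MonoidAlgebra ℤ (K ≃ₐ[ℚ] K)) :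
    galPow ε θ = 1 ∨ galPow ε θ = -1 := by
  rw [← sq_eq_one_iff, ← galPow_pow, sq_eq_one_iff.2 hε]
  simp [galPow, Finsupp.prod]

end GaloisPower

/-! ### The identities between `P`, `Q` and `Q₁` -/

section Exponents

variable {p : ℕ} [hp : Fact p.Prime]

theorem vpow_add_vpow_of_neg {v : (ZMod p)ˣ} {k l : ℤ} (h : v ^ l = -v ^ k) :
    vpow v l + vpow v k = p := by
  have : NeZero ((v ^ k : (ZMod p)ˣ) : ZMod p) := ⟨Units.ne_zero _⟩
  rw [vpow, vpow, h, Units.val_neg, ZMod.val_neg_of_ne_zero, ← Nat.cast_add,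
    Nat.sub_add_cancel (ZMod.val_lt _).le]

variable {v : (ZMod p)ˣ} (hv : ∀ u : (ZMod p)ˣ, u ∈ Subgroup.zpowers v)

include hv in
theorem orderOf_primitive : orderOf v = p - 1 := by
  rw [orderOf_eq_card_of_forall_mem_zpowers hv, Nat.card_eq_fintype_card, ZMod.card_units]

include hv in
theorem pow_half_eq_neg_one (hp2 : p ≠ 2) : v ^ ((p - 1) / 2) = -1 := by
  have h2 := hp.out.two_le
  have hodd := hp.out.odd_of_ne_two hp2
  have h : (v ^ ((p - 1) / 2)) ^ 2 = 1 := by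
    rw [← pow_mul, Nat.div_mul_cancel (by obtain ⟨k, hk⟩ := hodd; exact ⟨k, by lia⟩),
      ← orderOf_primitive hv, pow_orderOf_eq_one]
  have h' : ((v ^ ((p - 1) / 2) : (ZMod p)ˣ) : ZMod p) = 1 ∨
      ((v ^ ((p - 1) / 2) : (ZMod p)ˣ) : ZMod p) = -1 := by
    rw [← sq_eq_one_iff, ← Units.val_pow_eq_pow_val, h, Units.val_one]
  rcases h' with h' | h'
  · rw [Units.val_eq_one] at h'
    have := Nat.le_of_dvd (by lia) (orderOf_dvd_of_pow_eq_one h')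
    rw [orderOf_primitive hv] at this
    lia
  · exact Units.ext h'

include hv in
theorem vpow_neg_add_half (hp2 : p ≠ 2) (k : ℤ) :
    vpow v (-(k + ((p - 1) / 2 : ℕ))) = p - vpow v (-k) := by
  rw [eq_sub_iff_add_eq]
  refine vpow_add_vpow_of_neg ?_
  rw [neg_add, zpow_add, zpow_neg v ((p - 1) / 2 : ℕ), zpow_natCast, pow_half_eq_neg_one hv hp2,
    inv_neg, inv_one, mul_neg, mul_one]

include hv in
theorem delta_add_half (hp2 : p ≠ 2) (i : ℕ) :
    delta v (i + (p - 1) / 2) = 1 - vpow v 1 - delta v i := by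
  have h0 : (p : ℤ) ≠ 0 := by exact_mod_cast hp.out.ne_zero
  refine mul_left_cancel₀ h0 ?_
  rw [mul_sub, p_mul_delta, p_mul_delta, Nat.cast_add,
    show ((i : ℤ) + ((p - 1) / 2 : ℕ) - 1) = (i - 1) + ((p - 1) / 2 : ℕ) by ring,
    vpow_neg_add_half hv hp2, vpow_neg_add_half hv hp2]
  ring

open Polynomial

/-- The exponent `Q(σ) = ∑_{i=0}^{p-2} δ_i σ^i`, in terms of which `P(σ) (σ - v) = p Q(σ)`. -/
noncomputable def Q {B : Type*} [Ring B] (v : (ZMod p)ˣ) (s : B) : B :=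
  ∑ i ∈ Finset.range (p - 1), delta v i • s ^ i

include hv in
theorem sub_mul_sum_vpow {B : Type*} [Ring B] {s : B} (hs : s ^ (p - 1) = 1) :
    (s - vpow v 1 • 1) * ∑ i ∈ Finset.range (p - 1), vpow v (-(i : ℤ)) • s ^ i =
      (p : ℤ) • Q v s := by
  have h0 : v ^ (p - 1) = 1 := by rw [← orderOf_primitive hv, pow_orderOf_eq_one]
  have h1 : s * ∑ i ∈ Finset.range (p - 1), vpow v (-(i : ℤ)) • s ^ i =
      ∑ i ∈ Finset.range (p - 1), vpow v (-((i : ℤ) - 1)) • s ^ i := by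
    let t : ℕ → B := fun i => vpow v (-((i : ℤ) - 1)) • s ^ i
    have h2 := (Finset.sum_range_succ t (p - 1)).symm.trans (Finset.sum_range_succ' t (p - 1))
    simp only [t] at h2
    rw [hs, pow_zero, show vpow v (-(((p - 1 : ℕ) : ℤ) - 1)) = vpow v (-(((0 : ℕ) : ℤ) - 1)) by
      rw [vpow, vpow, neg_sub, neg_sub, zpow_sub, zpow_natCast, h0]; simp, add_left_inj] at h2
    rw [h2, Finset.mul_sum]
    refine Finset.sum_congr rfl fun i _ => ?_
    rw [mul_smul_comm, ← pow_succ', Nat.cast_add_one, add_sub_cancel_right]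
  rw [sub_mul, h1, smul_mul_assoc, one_mul, Finset.smul_sum, ← Finset.sum_sub_distrib, Q,
    Finset.smul_sum]
  refine Finset.sum_congr rfl fun i _ => ?_
  rw [smul_smul, smul_smul, p_mul_delta, sub_smul, mul_comm (vpow v 1)]

theorem sum_range_half (hp2 : p ≠ 2) {M : Type*} [AddCommMonoid M] (f : ℕ → M) :
    ∑ i ∈ Finset.range (p - 1), f i = ∑ i ∈ Finset.range ((p - 1) / 2), f i +
      ∑ i ∈ Finset.range ((p - 1) / 2), f ((p - 1) / 2 + i) := by
  obtain ⟨k, hk⟩ := hp.out.odd_of_ne_two hp2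
  rw [← Finset.sum_range_add, show (p - 1) / 2 + (p - 1) / 2 = p - 1 by lia]

include hv in
theorem sub_one_mul_Q_polynomial (hp2 : p ≠ 2) :
    (X - 1) * Q v (X : ℤ[X]) = ((1 - X) * ∑ i ∈ Finset.range ((p - 1) / 2), delta v i • X ^ i
      + (1 - vpow v 1) • X ^ ((p - 1) / 2)) * (X ^ ((p - 1) / 2) - 1) := by
  have h1 : Q v (X : ℤ[X]) = ∑ i ∈ Finset.range ((p - 1) / 2), delta v i • X ^ i
      + X ^ ((p - 1) / 2) * ((1 - vpow v 1) • ∑ i ∈ Finset.range ((p - 1) / 2), X ^ i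
        - ∑ i ∈ Finset.range ((p - 1) / 2), delta v i • X ^ i) := by
    rw [Q, sum_range_half hp2, Finset.smul_sum, ← Finset.sum_sub_distrib, Finset.mul_sum]
    congr 1
    refine Finset.sum_congr rfl fun i _ => ?_
    rw [add_comm _ i, delta_add_half hv hp2, sub_smul, pow_add, mul_sub, mul_smul_comm,
      mul_smul_comm, mul_comm (X ^ i)]
  have h2 := geom_sum_mul (X : ℤ[X]) ((p - 1) / 2)
  rw [h1]
  simp only [zsmul_eq_mul]
  linear_combination (X ^ ((p - 1) / 2) * ((1 - vpow v 1 : ℤ) : ℤ[X])) * h2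

include hv in
theorem sub_one_mul_Q (hp2 : p ≠ 2) {B : Type*} [Ring B] (s : B) :
    (s - 1) * Q v s = ((1 - s) * ∑ i ∈ Finset.range ((p - 1) / 2), delta v i • s ^ i
      + (1 - vpow v 1) • s ^ ((p - 1) / 2)) * (s ^ ((p - 1) / 2) - 1) := by
  simpa [Q, -zsmul_eq_mul] using congrArg (aeval s) (sub_one_mul_Q_polynomial hv hp2)

include hv in
theorem half_add_one_mul_sum_vpow_polynomial (hp2 : p ≠ 2) :
    (X ^ ((p - 1) / 2) + 1) * ∑ i ∈ Finset.range (p - 1), vpow v (-(i : ℤ)) • (X : ℤ[X]) ^ i =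
      (p : ℤ) • ∑ i ∈ Finset.range (p - 1), X ^ i + (X ^ ((p - 1) / 2 * 2) - 1) *
        ∑ i ∈ Finset.range ((p - 1) / 2), ((p : ℤ) - vpow v (-(i : ℤ))) • X ^ i := by
  have h1 : ∑ i ∈ Finset.range ((p - 1) / 2),
        vpow v (-(((p - 1) / 2 + i : ℕ) : ℤ)) • (X : ℤ[X]) ^ ((p - 1) / 2 + i) =
      X ^ ((p - 1) / 2) * ∑ i ∈ Finset.range ((p - 1) / 2),
        ((p : ℤ) - vpow v (-(i : ℤ))) • X ^ i := by
    rw [Finset.mul_sum]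
    refine Finset.sum_congr rfl fun i _ => ?_
    rw [add_comm _ i, Nat.cast_add, vpow_neg_add_half hv hp2, pow_add, mul_smul_comm,
      mul_comm (X ^ i)]
  have h2 : ∑ i ∈ Finset.range ((p - 1) / 2), (X : ℤ[X]) ^ ((p - 1) / 2 + i) =
      X ^ ((p - 1) / 2) * ∑ i ∈ Finset.range ((p - 1) / 2), X ^ i := by
    rw [Finset.mul_sum]
    simp only [pow_add]
  rw [sum_range_half hp2, sum_range_half hp2, h1, h2]
  simp only [sub_smul, Finset.sum_sub_distrib, ← Finset.smul_sum]
  simp only [zsmul_eq_mul]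
  ring

include hv in
/-- The residues `v^{-i}` and `v^{-(i + (p - 1) / 2)}` add up to `p`. -/
theorem half_add_one_mul_sum_vpow (hp2 : p ≠ 2) {B : Type*} [Ring B] {s : B}
    (hs : s ^ (p - 1) = 1) :
    (s ^ ((p - 1) / 2) + 1) * ∑ i ∈ Finset.range (p - 1), vpow v (-(i : ℤ)) • s ^ i =
      (p : ℤ) • ∑ i ∈ Finset.range (p - 1), s ^ i := by
  have h : s ^ ((p - 1) / 2 * 2) = 1 := by
    obtain ⟨k, hk⟩ := hp.out.odd_of_ne_two hp2
    rwa [show (p - 1) / 2 * 2 = p - 1 by lia]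
  simpa [-zsmul_eq_mul, h] using congrArg (aeval s) (half_add_one_mul_sum_vpow_polynomial hv hp2)

end Exponents

/-! ### Semiprimary numbers -/

section Semiprimary

variable {K : Type*} [Field K] {p : ℕ} [hp : Fact p.Prime] {ζ : K} (hζ : IsPrimitiveRoot ζ p)

/-- A number is semiprimary if it is a quotient of two algebraic integers that are congruent to
rational integers prime to `p` modulo `π ^ 2`. Allowing quotients makes this a condition closed
under inverses, hence under exponents from the group ring. -/
def IsSemiprimary (p : ℕ) (π : 𝓞 K) (x : K) : Prop :=
  ∃ y z : 𝓞 K, ∃ b c : ℤ, ¬ (p : ℤ) ∣ b ∧ ¬ (p : ℤ) ∣ c ∧ π ^ 2 ∣ y - b ∧ π ^ 2 ∣ z - c ∧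
    z ≠ 0 ∧ x * z = y

variable {π : 𝓞 K} {x y : K}

theorem isSemiprimary_of_dvd {y : 𝓞 K} {b : ℤ} (hb : ¬ (p : ℤ) ∣ b)
    (h : π ^ 2 ∣ y - b) : IsSemiprimary p π (y : K) :=
  ⟨y, 1, b, 1, hb, (Nat.prime_iff_prime_int.1 hp.out).not_dvd_one, h, by simp, one_ne_zero, by simp⟩

theorem IsSemiprimary.mul (hx : IsSemiprimary p π x) (hy : IsSemiprimary p π y) :
    IsSemiprimary p π (x * y) := by
  obtain ⟨x1, x2, b1, b2, hb1, hb2, h1, h2, hx2, h⟩ := hx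
  obtain ⟨y1, y2, c1, c2, hc1, hc2, k1, k2, hy2, k⟩ := hy
  have hprime := Nat.prime_iff_prime_int.1 hp.out
  refine ⟨x1 * y1, x2 * y2, b1 * c1, b2 * c2, hprime.not_dvd_mul hb1 hc1,
    hprime.not_dvd_mul hb2 hc2, ?_, ?_, mul_ne_zero hx2 hy2, ?_⟩
  · rw [show x1 * y1 - ((b1 * c1 : ℤ) : 𝓞 K) = (x1 - b1) * y1 + b1 * (y1 - c1) by
      push_cast; ring]
    exact dvd_add (h1.mul_right _) (k1.mul_left _)
  · rw [show x2 * y2 - ((b2 * c2 : ℤ) : 𝓞 K) = (x2 - b2) * y2 + b2 * (y2 - c2) by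
      push_cast; ring]
    exact dvd_add (h2.mul_right _) (k2.mul_left _)
  · rw [RingOfIntegers.coe_eq_algebraMap, RingOfIntegers.coe_eq_algebraMap, map_mul, map_mul,
      ← RingOfIntegers.coe_eq_algebraMap, ← RingOfIntegers.coe_eq_algebraMap x1, ← h,
      ← RingOfIntegers.coe_eq_algebraMap y1, ← k]
    ring

omit hp in
theorem IsSemiprimary.inv (hx0 : x ≠ 0) (hx : IsSemiprimary p π x) : IsSemiprimary p π x⁻¹ := by
  obtain ⟨x1, x2, b1, b2, hb1, hb2, h1, h2, hx2, h⟩ := hx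
  refine ⟨x2, x1, b2, b1, hb2, hb1, h2, h1, ?_, ?_⟩
  · rintro rfl
    rw [RingOfIntegers.coe_eq_algebraMap 0, map_zero, mul_eq_zero] at h
    exact h.elim hx0 fun h => hx2 (by simpa using h)
  · rw [← h, inv_mul_cancel_left₀ hx0]

theorem isSemiprimary_one : IsSemiprimary p π (1 : K) := by
  have h1 : ¬ (p : ℤ) ∣ 1 := (Nat.prime_iff_prime_int.1 hp.out).not_dvd_one
  exact ⟨1, 1, 1, 1, h1, h1, by simp, by simp, one_ne_zero, by simp⟩

theorem IsSemiprimary.zpow (hx0 : x ≠ 0) (hx : IsSemiprimary p π x) (n : ℤ) :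
    IsSemiprimary p π (x ^ n) := by
  have hpow : ∀ n : ℕ, IsSemiprimary p π (x ^ n) := fun n => by
    induction n with
    | zero => simpa using isSemiprimary_one
    | succ n ih => rw [pow_succ]; exact ih.mul hx
  cases n with
  | ofNat n => simpa using hpow n
  | negSucc n => rw [zpow_negSucc]; exact (hpow _).inv (pow_ne_zero _ hx0)

omit hp in
theorem IsSemiprimary.neg (hx : IsSemiprimary p π x) : IsSemiprimary p π (-x) := by
  obtain ⟨x1, x2, b1, b2, hb1, hb2, h1, h2, hx2, h⟩ := hx
  refine ⟨-x1, x2, -b1, b2, by rwa [dvd_neg], hb2, ?_, h2, hx2, by simp [h]⟩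
  rw [Int.cast_neg, ← neg_add', ← sub_eq_add_neg, dvd_neg]
  exact h1

theorem toInteger_sub_one_sq_dvd_intCast (hp2 : p ≠ 2) {n : ℤ} (h : (p : ℤ) ∣ n) :
    (hζ.toInteger - 1) ^ 2 ∣ (n : 𝓞 K) := by
  obtain ⟨z, -, hz⟩ := hζ.toInteger_isPrimitiveRoot.self_sub_one_pow_dvd_order (k := 2)
    (by have := hp.out.two_le; lia)
  obtain ⟨m, rfl⟩ := h
  rw [Int.cast_mul, Int.cast_natCast, hz]
  exact (dvd_mul_left _ _).mul_right _

/-- The `p`-th power of the Gauss sum is semiprimary, in fact congruent to `-1`, because all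
Jacobi sums of characters of order dividing `p` are congruent to `-1` modulo `π ^ 2`. -/
theorem isSemiprimary_gaussPow (hp2 : p ≠ 2) {F : Type*} [Field F] [Fintype F]
    (hF : p ∣ Fintype.card F - 1) {χ : MulChar F (𝓞 K)} (hχ : χ ^ p = 1) :
    IsSemiprimary p (hζ.toInteger - 1) ((gaussPow p χ : 𝓞 K) : K) := by
  have hp3 : 2 < p := by have := hp.out.two_le; lia
  have h1 : ¬ (p : ℤ) ∣ 1 := (Nat.prime_iff_prime_int.1 hp.out).not_dvd_one
  have hodd := hp.out.odd_of_ne_two hp2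
  refine isSemiprimary_of_dvd (b := -1) (by rwa [dvd_neg]) ?_
  set I := Ideal.span {(hζ.toInteger - 1) ^ 2} with hI
  have hJ : ∀ i, Ideal.Quotient.mk I (jacobiSum χ (χ ^ i)) = -1 := fun i => by
    obtain ⟨z, -, hz⟩ := exists_jacobiSum_eq_neg_one_add hp3 hχ
      (by rw [pow_right_comm, hχ, one_pow] : (χ ^ i) ^ p = 1) hF hζ.toInteger_isPrimitiveRoot
    rw [hz, map_add, map_neg, map_one, add_eq_left, Ideal.Quotient.eq_zero_iff_mem]
    exact Ideal.mul_mem_left _ _ (Ideal.mem_span_singleton_self _)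
  have hc : Ideal.Quotient.mk I (Fintype.card F : 𝓞 K) = 1 := by
    rw [← sub_eq_zero, ← map_one (Ideal.Quotient.mk I), ← map_sub, Ideal.Quotient.eq_zero_iff_mem,
      Ideal.mem_span_singleton]
    have := toInteger_sub_one_sq_dvd_intCast hζ hp2 (Int.natCast_dvd_natCast.2 hF)
    rwa [Int.cast_natCast, Nat.cast_sub Fintype.card_pos, Nat.cast_one] at this
  rw [← Ideal.mem_span_singleton, ← hI, ← Ideal.Quotient.eq_zero_iff_mem, gaussPow,
    apply_neg_one_of_pow_eq_one hodd hχ, one_mul, map_sub, map_mul, map_prod, hc,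
    Finset.prod_congr rfl fun i _ => hJ i, Finset.prod_const, Nat.card_Ico, one_mul, map_intCast]
  have : Odd (p - 1 - 1) := by
    obtain ⟨k, hk⟩ := hodd
    exact ⟨k - 1, by lia⟩
  rw [this.neg_one_pow]
  simp

variable [NumberField K]

/-- The automorphism of the ring of integers induced by an automorphism of the field. -/
noncomputable abbrev act (τ : K ≃ₐ[ℚ] K) : 𝓞 K ≃+* 𝓞 K := RingOfIntegers.mapRingEquiv τ.toRingEquiv

theorem act_zeta (τ : K ≃ₐ[ℚ] K) :
    act τ hζ.toInteger = hζ.toInteger ^ ((hζ.autToPow ℚ τ : (ZMod p)ˣ) : ZMod p).val := by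
  apply RingOfIntegers.ext
  rw [RingOfIntegers.mapRingEquiv_apply, RingOfIntegers.coe_eq_algebraMap (hζ.toInteger ^ _),
    map_pow]
  exact (hζ.autToPow_spec ℚ τ).symm

theorem toInteger_sub_one_dvd_act (τ : K ≃ₐ[ℚ] K) :
    hζ.toInteger - 1 ∣ act τ (hζ.toInteger - 1) := by
  rw [map_sub, map_one, act_zeta hζ]
  simpa using sub_dvd_pow_sub_pow hζ.toInteger 1 _

theorem IsSemiprimary.map {x : K} (hx : IsSemiprimary p (hζ.toInteger - 1) x) (τ : K ≃ₐ[ℚ] K) :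
    IsSemiprimary p (hζ.toInteger - 1) (τ x) := by
  obtain ⟨x1, x2, b1, b2, hb1, hb2, h1, h2, hx2, h⟩ := hx
  have key : ∀ (y : 𝓞 K) (b : ℤ), (hζ.toInteger - 1) ^ 2 ∣ y - b →
      (hζ.toInteger - 1) ^ 2 ∣ act τ y - b := fun y b hy => by
    refine (pow_dvd_pow_of_dvd (toInteger_sub_one_dvd_act hζ τ) 2).trans ?_
    rw [← map_pow, ← map_intCast (act τ), ← map_sub]
    exact map_dvd _ hy
  refine ⟨act τ x1, act τ x2, b1, b2, hb1, hb2, key _ _ h1, key _ _ h2, by simpa using hx2, ?_⟩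
  rw [RingOfIntegers.mapRingEquiv_apply, RingOfIntegers.mapRingEquiv_apply, ← h]
  exact (map_mul τ x (x2 : K)).symm

theorem IsSemiprimary.galPow {x : K} (hx0 : x ≠ 0) (hx : IsSemiprimary p (hζ.toInteger - 1) x)
    (θ : MonoidAlgebra ℤ (K ≃ₐ[ℚ] K)) : IsSemiprimary p (hζ.toInteger - 1) (galPow x θ) := by
  induction θ using MonoidAlgebra.induction_linear with
  | zero => rw [galPow_zero]; exact isSemiprimary_one
  | add θ₁ θ₂ h₁ h₂ => rw [galPow_add hx0]; exact h₁.mul h₂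
  | single g n => rw [galPow_single]; exact (IsSemiprimary.map hζ hx g).zpow (by simpa using hx0) n

variable [IsCyclotomicExtension {p} ℚ K]

/-- Among the `p`-th roots of unity only `1` is semiprimary, as `ζ ^ r ≡ 1 + r π` modulo `π ^ 2`. -/
theorem dvd_of_isSemiprimary_pow (hp2 : p ≠ 2) {r : ℕ}
    (h : IsSemiprimary p (hζ.toInteger - 1) (ζ ^ r)) : p ∣ r := by
  obtain ⟨y, z, b, c, hb, hc, hy, hz, hz0, h⟩ := h
  have hprime := Nat.prime_iff_prime_int.1 hp.out
  set π := hζ.toInteger - 1 with hπ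
  have hπ0 : π ≠ 0 := (hζ.zeta_sub_one_prime').ne_zero
  have hdvd : ∀ n : ℤ, π ∣ (n : 𝓞 K) ↔ (p : ℤ) ∣ n := fun n =>
    IsCyclotomicExtension.Rat.zeta_sub_one_dvd_intCast_iff' p hζ
  have hζr : π ^ 2 ∣ hζ.toInteger ^ r - 1 - r * π := by
    clear h
    induction r with
    | zero => simp
    | succ r ih =>
      rw [show hζ.toInteger ^ (r + 1) - 1 - ((r + 1 : ℕ) : 𝓞 K) * π =
        (hζ.toInteger ^ r - 1 - r * π) * hζ.toInteger + π ^ 2 * r by rw [hπ]; push_cast; ring]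
      exact dvd_add (ih.mul_right _) (dvd_mul_right _ _)
  replace h : hζ.toInteger ^ r * z = y := by
    apply RingOfIntegers.ext
    rw [← h, RingOfIntegers.coe_eq_algebraMap, map_mul, map_pow]
    rfl
  have h1 : π ^ 2 ∣ ((b - c : ℤ) : 𝓞 K) - ((c * r : ℤ) : 𝓞 K) * π := by
    rw [show ((b - c : ℤ) : 𝓞 K) - ((c * r : ℤ) : 𝓞 K) * π =
      (hζ.toInteger ^ r - 1 - r * π) * c + hζ.toInteger ^ r * (z - c) - (y - b) by
        rw [← h]; push_cast; ring]
    exact dvd_sub (dvd_add (hζr.mul_right _) (hz.mul_left _)) hy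
  have h2 : π ^ 2 ∣ ((b - c : ℤ) : 𝓞 K) := by
    refine toInteger_sub_one_sq_dvd_intCast hζ hp2 ((hdvd _).1 ?_)
    exact (dvd_sub_left (dvd_mul_left _ _)).1 ((dvd_pow_self π two_ne_zero).trans h1)
  have h3 : π ∣ ((c * r : ℤ) : 𝓞 K) := by
    rw [dvd_sub_right h2, sq] at h1
    exact (mul_dvd_mul_iff_right hπ0).1 h1
  exact_mod_cast ((hprime.dvd_or_dvd ((hdvd _).1 h3)).resolve_left hc)

/-- A semiprimary number of finite multiplicative order is `1` or `-1`. -/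
theorem IsSemiprimary.eq_one_or_eq_neg_one (hp2 : p ≠ 2) {x : K}
    (hx : IsSemiprimary p (hζ.toInteger - 1) x) (hfin : IsOfFinOrder x) : x = 1 ∨ x = -1 := by
  obtain ⟨r, -, h⟩ := hζ.exists_pow_or_neg_mul_pow_of_isOfFinOrder (hp.out.odd_of_ne_two hp2) hfin
  have hr : p ∣ r := by
    refine dvd_of_isSemiprimary_pow hζ hp2 ?_
    rcases h with rfl | rfl
    · exact hx
    · simpa using hx.neg
  rwa [(hζ.pow_eq_one_iff_dvd r).2 hr] at h

end Semiprimary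

/-! ### The Galois group -/

section Galois

variable {K : Type*} [Field K] [NumberField K] {p : ℕ} [hp : Fact p.Prime] {ζ : K}
  (hζ : IsPrimitiveRoot ζ p)

theorem autToPow_eq {τ : K ≃ₐ[ℚ] K} {u : (ZMod p)ˣ} (h : τ ζ = ζ ^ (u : ZMod p).val) :
    hζ.autToPow ℚ τ = u := by
  refine Units.ext (ZMod.val_injective p (hζ.pow_inj (ZMod.val_lt _) (ZMod.val_lt _) ?_))
  rw [hζ.autToPow_spec ℚ τ, h]

/-- Galois conjugation of a Gauss sum of order `p` raises its character to a power. -/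
theorem act_gaussPow {F : Type*} [CommRing F] [Fintype F] {χ : MulChar F (𝓞 K)} (hχ : χ ^ p = 1)
    (τ : K ≃ₐ[ℚ] K) :
    act τ (gaussPow p χ) = gaussPow p (χ ^ ((hζ.autToPow ℚ τ : (ZMod p)ˣ) : ZMod p).val) := by
  rw [← RingEquiv.coe_toRingHom, ← gaussPow_ringHomComp]
  congr 1
  refine MulChar.ext fun x => ?_
  obtain ⟨i, -, hi⟩ := hζ.toInteger_isPrimitiveRoot.eq_pow_of_pow_eq_one (ξ := χ x)
    (by rw [← MulChar.pow_apply_coe, hχ, MulChar.one_apply_coe])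
  rw [MulChar.ringHomComp_apply, MulChar.pow_apply_coe, ← hi, RingEquiv.coe_toRingHom, map_pow,
    act_zeta hζ, pow_right_comm]

variable {v : (ZMod p)ˣ} {σ J : K ≃ₐ[ℚ] K}

include hζ in
theorem conj_zeta (hJ : ∀ φ : K →+* ℂ, ComplexEmbedding.IsConj φ J) : J ζ = ζ⁻¹ := by
  obtain ⟨φ⟩ : Nonempty (K →+* ℂ) := inferInstance
  apply φ.injective
  rw [(hJ φ).eq, map_inv₀, Complex.star_def]
  refine (Complex.inv_eq_conj ?_).symm
  exact Complex.norm_eq_one_of_pow_eq_one (by rw [← map_pow, hζ.pow_eq_one, map_one])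
    hp.out.ne_zero

variable [IsCyclotomicExtension {p} ℚ K] (hv : ∀ u : (ZMod p)ˣ, u ∈ Subgroup.zpowers v)
  (hσ : σ ζ = ζ ^ (v : ZMod p).val)

include hv hσ hζ

theorem sigma_pow_sub_one : σ ^ (p - 1) = 1 := by
  apply hζ.autToPow_injective ℚ
  rw [map_pow, autToPow_eq hζ hσ, map_one, ← orderOf_primitive hv, pow_orderOf_eq_one]

theorem conj_eq_sigma_pow (hp2 : p ≠ 2) (hJ : ∀ φ : K →+* ℂ, ComplexEmbedding.IsConj φ J) :
    J = σ ^ ((p - 1) / 2) := by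
  apply hζ.autToPow_injective ℚ
  rw [map_pow, autToPow_eq hζ hσ, pow_half_eq_neg_one hv hp2]
  refine autToPow_eq hζ ?_
  rw [conj_zeta hζ hJ, Units.val_neg, Units.val_one, ZMod.val_neg_of_ne_zero, ZMod.val_one]
  refine inv_eq_of_mul_eq_one_right ?_
  rw [← pow_succ', Nat.sub_add_cancel hp.out.one_le, hζ.pow_eq_one]

theorem prod_sigma_pow (x : K) :
    ∏ i ∈ Finset.range (p - 1), (σ ^ i) x = algebraMap ℚ K (Algebra.norm ℚ x) := by
  have := IsCyclotomicExtension.isGalois {p} ℚ K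
  classical
  rw [Algebra.norm_eq_prod_automorphisms]
  have hor := orderOf_primitive hv
  refine Finset.prod_bij (fun i _ => σ ^ i) (fun _ _ => Finset.mem_univ _) ?_ ?_ fun _ _ => rfl
  · intro i hi j hj h
    have h' := congrArg (hζ.autToPow ℚ) h
    rw [map_pow, map_pow, autToPow_eq hζ hσ] at h'
    rw [Finset.mem_range, ← hor] at hi hj
    exact pow_injOn_Iio_orderOf hi hj h'
  · intro τ _
    obtain ⟨i, hi⟩ := Finset.mem_image.1
      ((mem_zpowers_iff_mem_range_orderOf (x := v)).1 (hv (hζ.autToPow ℚ τ)))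
    refine ⟨i, hor ▸ hi.1, ?_⟩
    apply hζ.autToPow_injective ℚ
    rw [map_pow, autToPow_eq hζ hσ, hi.2]

end Galois

/-! ### The factorization of the Gauss sum -/

section Factorization

variable {K : Type*} [Field K] [NumberField K] {p : ℕ} [hp : Fact p.Prime] {ζ : K}
  (hζ : IsPrimitiveRoot ζ p) {q : ℕ} [hq : Fact q.Prime] {𝔮 : Ideal (𝓞 K)} [𝔮.IsPrime]
  [𝔮.LiesOver (Ideal.span {(q : ℤ)})]

/-- The decomposition group of `𝔮` consists of powers of the Frobenius `ζ ↦ ζ ^ q`. -/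
theorem exists_autToPow_eq_pow (h𝔮 : 𝔮 ≠ ⊥) (hqp : q ≠ p) {f : ℕ}
    (hf : Nat.card (𝓞 K ⧸ 𝔮) = q ^ f) {τ : K ≃ₐ[ℚ] K}
    (hτ : 𝔮 = Ideal.map (act τ : 𝓞 K →+* 𝓞 K) 𝔮) :
    ∃ l < f, ((hζ.autToPow ℚ τ : (ZMod p)ˣ) : ZMod p) = (q : ZMod p) ^ l := by
  have : 𝔮.IsMaximal := isMaximal_of_liesOver (q := q)
  let := Ideal.Quotient.field 𝔮
  have : Finite (𝓞 K ⧸ 𝔮) := Ideal.finiteQuotientOfFreeOfNeBot 𝔮 h𝔮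
  let := Fintype.ofFinite (𝓞 K ⧸ 𝔮)
  have : CharP (𝓞 K ⧸ 𝔮) q := charP_quotient
  let := ZMod.algebra (𝓞 K ⧸ 𝔮) q
  -- `τ` induces an automorphism of the residue field, which is a power of Frobenius
  let e := Ideal.quotientEquiv 𝔮 𝔮 (act τ) hτ
  let e' : (𝓞 K ⧸ 𝔮) ≃ₐ[ZMod q] (𝓞 K ⧸ 𝔮) := AlgEquiv.ofRingEquiv (f := e) fun x =>
    RingHom.congr_fun (Subsingleton.elim ((e : (𝓞 K ⧸ 𝔮) →+* 𝓞 K ⧸ 𝔮).comp (algebraMap (ZMod q) _))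
      (algebraMap (ZMod q) (𝓞 K ⧸ 𝔮))) x
  obtain ⟨l, hl⟩ := (FiniteField.bijective_frobeniusAlgEquivOfAlgebraic_pow (ZMod q)
    (𝓞 K ⧸ 𝔮)).2 e'
  have hfin : Module.finrank (ZMod q) (𝓞 K ⧸ 𝔮) = f := by
    have h := Module.card_eq_pow_finrank (K := ZMod q) (V := 𝓞 K ⧸ 𝔮)
    rw [← Nat.card_eq_fintype_card, hf, ZMod.card] at h
    exact (Nat.pow_right_injective hq.out.two_le h).symm
  refine ⟨l, hfin ▸ l.2, ?_⟩
  have h1 := DFunLike.congr_fun hl (Ideal.Quotient.mk 𝔮 hζ.toInteger)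
  have h2 : e' (Ideal.Quotient.mk 𝔮 hζ.toInteger) =
      Ideal.Quotient.mk 𝔮 (act τ hζ.toInteger) := rfl
  rw [h2, act_zeta hζ, AlgEquiv.coe_pow, FiniteField.coe_frobeniusAlgEquivOfAlgebraic_iterate,
    ZMod.card] at h1
  beta_reduce at h1
  rw [← map_pow] at h1
  have h3 := eq_of_mk_eq_of_pow_eq_one hζ.toInteger_isPrimitiveRoot
    (natCast_quotient_ne_zero (q := q) hqp)
    (by rw [pow_right_comm, hζ.toInteger_isPrimitiveRoot.pow_eq_one, one_pow])
    (by rw [pow_right_comm, hζ.toInteger_isPrimitiveRoot.pow_eq_one, one_pow]) h1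
  have hfin : IsOfFinOrder hζ.toInteger :=
    isOfFinOrder_iff_pow_eq_one.2 ⟨p, hp.out.pos, hζ.toInteger_isPrimitiveRoot.pow_eq_one⟩
  rw [hfin.pow_eq_pow_iff_modEq, ← hζ.toInteger_isPrimitiveRoot.eq_orderOf,
    ← ZMod.natCast_eq_natCast_iff, ZMod.natCast_zmod_val, Nat.cast_pow] at h3
  exact h3.symm

variable {v : (ZMod p)ˣ} {σ : K ≃ₐ[ℚ] K}
  (hv : ∀ u : (ZMod p)ˣ, u ∈ Subgroup.zpowers v) (hσ : σ ζ = ζ ^ (v : ZMod p).val)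

/-- The conjugate `σ ^ i 𝔮` of a prime ideal. -/
noncomputable def conjIdeal (σ : K ≃ₐ[ℚ] K) (𝔮 : Ideal (𝓞 K)) (i : ℕ) : Ideal (𝓞 K) :=
  𝔮.map (act (σ ^ i) : 𝓞 K →+* 𝓞 K)

include hv hσ hζ in
/-- The exponent of a conjugate of `𝔮` in `𝔮 ^ P(σ)`. -/
theorem sum_filter_conjIdeal_le (h𝔮 : 𝔮 ≠ ⊥) (hqp : q ≠ p) {f : ℕ}
    (hf : Nat.card (𝓞 K ⧸ 𝔮) = q ^ f) (j : ℕ) [DecidableEq (Ideal (𝓞 K))] :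
    ∑ i ∈ Finset.range (p - 1) with conjIdeal σ 𝔮 i = conjIdeal σ 𝔮 j,
        ((v⁻¹ ^ i : (ZMod p)ˣ) : ZMod p).val ≤
      ∑ l ∈ Finset.range f, q ^ l * ((v⁻¹ ^ j : (ZMod p)ˣ) : ZMod p).val % p := by
  set s := {i ∈ Finset.range (p - 1) | conjIdeal σ 𝔮 i = conjIdeal σ 𝔮 j} with hs
  have key : ∀ i ∈ s, ∃ l < f, ((v⁻¹ ^ i : (ZMod p)ˣ) : ZMod p) =
      (q : ZMod p) ^ l * ((v⁻¹ ^ j : (ZMod p)ˣ) : ZMod p) := fun i hi => by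
    have h1 : conjIdeal σ 𝔮 i = conjIdeal σ 𝔮 j := (Finset.mem_filter.1 hi).2
    obtain ⟨l, hl, h⟩ := exists_autToPow_eq_pow hζ h𝔮 hqp hf (τ := (σ ^ i)⁻¹ * σ ^ j) (by
      have h2 := congrArg (Ideal.map (act (σ ^ i)⁻¹ : 𝓞 K →+* 𝓞 K)) h1
      rw [conjIdeal, conjIdeal, Ideal.map_map, Ideal.map_map] at h2
      convert h2 using 1
      have h3 : (act (σ ^ i)⁻¹ : 𝓞 K →+* 𝓞 K).comp (act (σ ^ i) : 𝓞 K →+* 𝓞 K) =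
          RingHom.id _ := by
        ext x
        exact (σ ^ i).symm_apply_apply (x : K)
      · rw [h3, Ideal.map_id]
      · rfl)
    refine ⟨l, hl, ?_⟩
    rw [← h, ← Units.val_mul, map_mul, map_inv, map_pow, map_pow, autToPow_eq hζ hσ, mul_assoc,
      ← mul_pow, mul_inv_cancel, one_pow, mul_one, inv_pow]
  choose! l hl hlv using key
  have hval : ∀ i ∈ s, ((v⁻¹ ^ i : (ZMod p)ˣ) : ZMod p).val =
      q ^ l i * ((v⁻¹ ^ j : (ZMod p)ˣ) : ZMod p).val % p := fun i hi => by
    rw [hlv i hi, ← ZMod.val_natCast, Nat.cast_mul, ZMod.natCast_zmod_val, Nat.cast_pow]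
  rw [Finset.sum_congr rfl hval]
  have hinj : Set.InjOn l s := fun i hi i' hi' h => by
    have h1 : v⁻¹ ^ i = v⁻¹ ^ i' := Units.ext (by rw [hlv i hi, hlv i' hi', h])
    have hor : orderOf v⁻¹ = p - 1 := by rw [orderOf_inv, orderOf_primitive hv]
    have hr : ∀ k ∈ s, k < orderOf v⁻¹ := fun k hk => by
      rw [hor]
      exact Finset.mem_range.1 (Finset.mem_filter.1 hk).1
    exact pow_injOn_Iio_orderOf (hr i hi) (hr i' hi') h1
  rw [← Finset.sum_image (f := fun l => q ^ l * ((v⁻¹ ^ j : (ZMod p)ˣ) : ZMod p).val % p) hinj]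
  refine Finset.sum_le_sum_of_subset fun k hk => ?_
  obtain ⟨i, hi, rfl⟩ := Finset.mem_image.1 hk
  exact Finset.mem_range.2 (hl i hi)

variable [IsCyclotomicExtension {p} ℚ K]

include hv hσ hζ in
/-- `𝔮 ^ P(σ)` divides the `p`-th power of the Gauss sum. -/
theorem prod_conjIdeal_dvd_gaussPow (hp2 : p ≠ 2) (h𝔮 : 𝔮 ≠ ⊥) (hqp : q ≠ p)
    [Fintype (𝓞 K ⧸ 𝔮)] {ρ : MulChar (𝓞 K ⧸ 𝔮) (𝓞 K)} (hρp : ρ ^ p = 1) (hρ1 : ρ ≠ 1)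
    (hρ : ∀ x : (𝓞 K ⧸ 𝔮)ˣ,
      Ideal.Quotient.mk 𝔮 (ρ x) = x ^ ((Nat.card (𝓞 K ⧸ 𝔮) - 1) / p)) :
    ∏ i ∈ Finset.range (p - 1), conjIdeal σ 𝔮 i ^ ((v⁻¹ ^ i : (ZMod p)ˣ) : ZMod p).val ∣
      Ideal.span {gaussPow p ρ⁻¹} := by
  classical
  have h𝔮max : 𝔮.IsMaximal := isMaximal_of_liesOver (q := q)
  obtain ⟨f, hf⟩ : ∃ f, Nat.card (𝓞 K ⧸ 𝔮) = q ^ f := by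
    let := Ideal.Quotient.field 𝔮
    have : CharP (𝓞 K ⧸ 𝔮) q := charP_quotient
    obtain ⟨f, -, hf⟩ := FiniteField.card (𝓞 K ⧸ 𝔮) q
    exact ⟨f, by rw [Nat.card_eq_fintype_card, hf]⟩
  rw [← Finset.prod_fiberwise_of_maps_to (t := (Finset.range (p - 1)).image (conjIdeal σ 𝔮))
    (g := conjIdeal σ 𝔮) (fun i hi => Finset.mem_image_of_mem _ hi)]
  have hmax : ∀ i, (conjIdeal σ 𝔮 i).IsMaximal := fun i =>
    Ideal.map_isMaximal_of_equiv (act (σ ^ i))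
  have hfib : ∀ 𝔯, ∏ i ∈ Finset.range (p - 1) with conjIdeal σ 𝔮 i = 𝔯,
      conjIdeal σ 𝔮 i ^ ((v⁻¹ ^ i : (ZMod p)ˣ) : ZMod p).val =
      𝔯 ^ ∑ i ∈ Finset.range (p - 1) with conjIdeal σ 𝔮 i = 𝔯,
        ((v⁻¹ ^ i : (ZMod p)ˣ) : ZMod p).val := fun 𝔯 => by
    rw [← Finset.prod_pow_eq_pow_sum]
    refine Finset.prod_congr rfl fun i hi => ?_
    rw [(Finset.mem_filter.1 hi).2]
  simp_rw [hfib]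
  refine Finset.prod_dvd_of_coprime ?_ ?_
  · intro 𝔯 h𝔯 𝔰 h𝔰 hne
    obtain ⟨i, -, rfl⟩ := Finset.mem_image.1 h𝔯
    obtain ⟨j, -, rfl⟩ := Finset.mem_image.1 h𝔰
    have := hmax i
    have := hmax j
    exact (Ideal.isCoprime_of_isMaximal hne).pow
  · intro 𝔯 h𝔯
    obtain ⟨j, -, rfl⟩ := Finset.mem_image.1 h𝔯
    refine (pow_dvd_pow _ (sum_filter_conjIdeal_le hζ hv hσ h𝔮 hqp hf j)).trans ?_
    rw [Ideal.dvd_span_singleton, conjIdeal, ← Ideal.map_pow]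
    have hmem : act (σ ^ j)⁻¹ (gaussPow p ρ⁻¹) ∈
        𝔮 ^ ∑ l ∈ Finset.range f, q ^ l * ((v⁻¹ ^ j : (ZMod p)ˣ) : ZMod p).val % p := by
      rw [act_gaussPow hζ (by rw [inv_pow, hρp, inv_one]), map_inv, map_pow, autToPow_eq hζ hσ,
        ← inv_pow]
      refine gaussPow_mem_pow hζ hp2 h𝔮 hqp hf hρp hρ1 hρ ?_ (ZMod.val_lt _)
      exact ZMod.val_pos.2 (Units.ne_zero _)
    have h := Ideal.mem_map_of_mem (act (σ ^ j) : 𝓞 K →+* 𝓞 K) hmem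
    convert h using 1
    apply RingOfIntegers.ext
    exact ((σ ^ j).apply_symm_apply _).symm

end Factorization

/-! ### The power of the Gauss sum and the singular integer -/

section Main

theorem gaussPow_mul_gaussPow_inv {F : Type*} [Field F] [Fintype F] {R : Type*} [CommRing R]
    [IsDomain R] {p : ℕ} [hp : Fact p.Prime] (hp2 : p ≠ 2) {χ : MulChar F R} (hχ : χ ≠ 1)
    (hχp : χ ^ p = 1) {ψ : AddChar F R} (hψ : ψ ≠ 1) :
    gaussPow p χ * gaussPow p χ⁻¹ = (Fintype.card F : R) ^ p := by
  have hχp' : χ⁻¹ ^ p = 1 := by rw [inv_pow, hχp, inv_one]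
  have h1 : gaussSum χ⁻¹ ψ⁻¹ = gaussSum χ⁻¹ ψ := by
    rw [← mul_gaussSum_inv_eq_gaussSum χ⁻¹ ψ,
      apply_neg_one_of_pow_eq_one (hp.out.odd_of_ne_two hp2) hχp', one_mul]
  rw [← gaussSum_pow_eq_gaussPow hχ hχp hψ,
    ← gaussSum_pow_eq_gaussPow (inv_ne_one.2 hχ) hχp' hψ, ← mul_pow, ← h1,
    gaussSum_mul_gaussSum_eq_card hχ (AddChar.IsPrimitive.of_ne_one hψ)]

variable {K : Type*} [Field K] [NumberField K] {p : ℕ} [hp : Fact p.Prime]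
  [IsCyclotomicExtension {p} ℚ K] {ζ : K} (hζ : IsPrimitiveRoot ζ p)
  {v : (ZMod p)ˣ} (hv : ∀ u : (ZMod p)ˣ, u ∈ Subgroup.zpowers v)
  {σ J : K ≃ₐ[ℚ] K} (hσ : σ ζ = ζ ^ (v : ZMod p).val)
  {q : ℕ} [hq : Fact q.Prime] {𝔮 : Ideal (𝓞 K)} [𝔮.IsPrime] [𝔮.LiesOver (Ideal.span {(q : ℤ)})]

omit [IsCyclotomicExtension {p} ℚ K] in
theorem galPow_P {x : K} (hx : x ≠ 0) :
    galPow x (P v σ) =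
      ∏ i ∈ Finset.range (p - 1), (σ ^ i) x ^ ((v⁻¹ ^ i : (ZMod p)ˣ) : ZMod p).val := by
  rw [P, galPow_sum hx]
  refine Finset.prod_congr rfl fun i _ => ?_
  rw [vpow, zpow_neg, zpow_natCast, ← inv_pow, galPow_natCast_smul hx, grp_pow, galPow_grp]

include hv hσ hζ in
/-- The square of the absolute value of `x ^ P(σ)` is a power of the norm, since the coefficients of
`σ ^ i` and `σ ^ (i + (p - 1) / 2)` in `P(σ)` add up to `p`. -/
theorem galPow_P_mul_conj (hp2 : p ≠ 2) (hJ : ∀ φ : K →+* ℂ, ComplexEmbedding.IsConj φ J) {x : K}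
    (hx : x ≠ 0) :
    J (galPow x (P v σ)) * galPow x (P v σ) = algebraMap ℚ K (Algebra.norm ℚ x) ^ p := by
  have hs : grp σ ^ (p - 1) = 1 := by
    rw [grp_pow, sigma_pow_sub_one hζ hv hσ]
    rfl
  have h := congrArg (galPow x) (half_add_one_mul_sum_vpow hv hp2 hs)
  rw [← P, galPow_mul hx, galPow_natCast_smul hx, galPow_sum hx,
    galPow_add (galPow_ne_zero hx _), galPow_one, grp_pow, galPow_grp,
    ← conj_eq_sigma_pow hζ hv hσ hp2 hJ] at h
  simp_rw [grp_pow, galPow_grp] at h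
  rw [h, prod_sigma_pow hζ hv hσ]

include hv hσ hζ in
/-- `A ^ P(σ)` divides the `p ^ 2`-th power of the Gauss sum. -/
theorem exists_mul_galPow_P_eq (hp2 : p ≠ 2) (h𝔮 : 𝔮 ≠ ⊥) (hqp : q ≠ p)
    [Fintype (𝓞 K ⧸ 𝔮)] {ρ : MulChar (𝓞 K ⧸ 𝔮) (𝓞 K)} (hρp : ρ ^ p = 1) (hρ1 : ρ ≠ 1)
    (hρ : ∀ x : (𝓞 K ⧸ 𝔮)ˣ,
      Ideal.Quotient.mk 𝔮 (ρ x) = x ^ ((Nat.card (𝓞 K ⧸ 𝔮) - 1) / p))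
    {A : 𝓞 K} (hA0 : (A : K) ≠ 0) (hA𝔮 : Ideal.span {A} = 𝔮 ^ p) :
    ∃ U : 𝓞 K, ((gaussPow p ρ⁻¹ : 𝓞 K) : K) ^ p = galPow (A : K) (P v σ) * U := by
  set B : 𝓞 K := ∏ i ∈ Finset.range (p - 1),
    act (σ ^ i) A ^ ((v⁻¹ ^ i : (ZMod p)ˣ) : ZMod p).val with hB
  have hBK : (B : K) = galPow (A : K) (P v σ) := by
    rw [galPow_P hA0, RingOfIntegers.coe_eq_algebraMap, hB, map_prod]
    simp_rw [map_pow]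
    rfl
  have hBspan : Ideal.span {B} = (∏ i ∈ Finset.range (p - 1),
      conjIdeal σ 𝔮 i ^ ((v⁻¹ ^ i : (ZMod p)ˣ) : ZMod p).val) ^ p := by
    rw [hB, ← Ideal.prod_span_singleton, ← Finset.prod_pow]
    refine Finset.prod_congr rfl fun i _ => ?_
    rw [← Ideal.span_singleton_pow, pow_right_comm, conjIdeal, ← Ideal.map_pow, ← hA𝔮,
      Ideal.map_span, Set.image_singleton]
    rfl
  obtain ⟨U, hU⟩ : B ∣ gaussPow p ρ⁻¹ ^ p := by
    rw [← Ideal.mem_span_singleton, ← Ideal.dvd_span_singleton, hBspan, ← Ideal.span_singleton_pow]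
    exact pow_dvd_pow_of_dvd
      (prod_conjIdeal_dvd_gaussPow hζ hv hσ hp2 h𝔮 hqp hρp hρ1 hρ) p
  refine ⟨U, ?_⟩
  rw [← hBK, RingOfIntegers.coe_eq_algebraMap, RingOfIntegers.coe_eq_algebraMap,
    RingOfIntegers.coe_eq_algebraMap, ← map_pow, ← map_mul, hU]

omit hp [IsCyclotomicExtension {p} ℚ K] [𝔮.IsPrime] in
theorem norm_eq_or_eq_neg {A : 𝓞 K} (hA𝔮 : Ideal.span {A} = 𝔮 ^ p) :
    Algebra.norm ℚ (A : K) = (Nat.card (𝓞 K ⧸ 𝔮) : ℚ) ^ p ∨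
      Algebra.norm ℚ (A : K) = -(Nat.card (𝓞 K ⧸ 𝔮) : ℚ) ^ p := by
  have h1 : (Algebra.norm ℤ A).natAbs = Nat.card (𝓞 K ⧸ 𝔮) ^ p := by
    rw [← Ideal.absNorm_span_singleton, hA𝔮, map_pow, Ideal.absNorm_apply, Submodule.cardQuot_apply]
  rw [← Algebra.coe_norm_int]
  rcases Int.natAbs_eq (Algebra.norm ℤ A) with h | h <;> rw [h, h1]
  · exact Or.inl (by push_cast; rfl)
  · exact Or.inr (by push_cast; rfl)

/-- An algebraic integer `U` with `J U * U = ±1` is a root of unity. -/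
theorem isOfFinOrder_of_conj_mul (hJ : ∀ φ : K →+* ℂ, ComplexEmbedding.IsConj φ J) {U : K}
    (hU : IsIntegral ℤ U) (h : J U * U = 1 ∨ J U * U = -1) : IsOfFinOrder U := by
  obtain ⟨n, hn, hUn⟩ := Embeddings.pow_eq_one_of_norm_eq_one K ℂ hU fun φ => by
    have h1 : ‖φ (J U * U)‖ = 1 := by rcases h with h | h <;> rw [h] <;> simp
    rw [map_mul, (hJ φ).eq, norm_mul, norm_star] at h1
    nlinarith [norm_nonneg (φ U)]
  exact isOfFinOrder_iff_pow_eq_one.2 ⟨n, hn, hUn⟩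

omit [𝔮.IsPrime] in
theorem isSemiprimary_of_span_eq (hqp : q ≠ p) {A : 𝓞 K}
    (hA𝔮 : Ideal.span {A} = 𝔮 ^ p) {a : ℕ} {n : ℕ} (hn : 1 < n)
    (hA : A - (a : 𝓞 K) ∈ Ideal.span {hζ.toInteger - 1} ^ n) :
    IsSemiprimary p (hζ.toInteger - 1) (A : K) := by
  have hdvd : ∀ m : ℤ, hζ.toInteger - 1 ∣ (m : 𝓞 K) ↔ (p : ℤ) ∣ m := fun m =>
    IsCyclotomicExtension.Rat.zeta_sub_one_dvd_intCast_iff' p hζ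
  rw [Ideal.span_singleton_pow, Ideal.mem_span_singleton] at hA
  refine isSemiprimary_of_dvd (b := a) (fun h => ?_)
    ((pow_dvd_pow _ hn).trans (by rwa [Int.cast_natCast]))
  -- otherwise `π` divides `A`, so `𝔮 ⊆ (π)` and `p ∣ q`
  rw [← hdvd, Int.cast_natCast] at h
  have hπA : hζ.toInteger - 1 ∣ A := by
    rw [← sub_add_cancel A (a : 𝓞 K)]
    exact dvd_add ((dvd_pow_self _ (by lia)).trans hA) h
  have hπ := hζ.zeta_sub_one_prime'
  have hprime : (Ideal.span {hζ.toInteger - 1}).IsPrime :=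
    (Ideal.span_singleton_prime hπ.ne_zero).2 hπ
  have hle : 𝔮 ≤ Ideal.span {hζ.toInteger - 1} := by
    refine hprime.le_of_pow_le (n := p) ?_
    rw [← hA𝔮]
    exact Ideal.span_singleton_le_span_singleton.2 hπA
  have hq' := Ideal.mem_span_singleton.1 (hle (natCast_mem_of_liesOver (q := q)))
  rw [← Int.cast_natCast, hdvd, Int.natCast_dvd_natCast, Nat.prime_dvd_prime_iff_eq hp.out hq.out]
    at hq'
  exact hqp hq'.symm

include hv hσ hζ in
/-- The first assertion, in terms of the `p`-th power of the Gauss sum. -/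
theorem gaussPow_pow_eq (hp2 : p ≠ 2) (hJ : ∀ φ : K →+* ℂ, ComplexEmbedding.IsConj φ J)
    (h𝔮 : 𝔮 ≠ ⊥) (hqp : q ≠ p) [Fintype (𝓞 K ⧸ 𝔮)] {ρ : MulChar (𝓞 K ⧸ 𝔮) (𝓞 K)}
    (hρp : ρ ^ p = 1) (hρ1 : ρ ≠ 1)
    (hρ : ∀ x : (𝓞 K ⧸ 𝔮)ˣ,
      Ideal.Quotient.mk 𝔮 (ρ x) = x ^ ((Nat.card (𝓞 K ⧸ 𝔮) - 1) / p))
    {A : 𝓞 K} (hA0 : (A : K) ≠ 0) (hA𝔮 : Ideal.span {A} = 𝔮 ^ p)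
    (hA : IsSemiprimary p (hζ.toInteger - 1) (A : K))
    (hG : IsSemiprimary p (hζ.toInteger - 1) ((gaussPow p ρ⁻¹ : 𝓞 K) : K))
    (hGG : J (gaussPow p ρ⁻¹ : 𝓞 K) * (gaussPow p ρ⁻¹ : 𝓞 K) =
      (Nat.card (𝓞 K ⧸ 𝔮) : K) ^ p) :
    ∃ ε : K, (ε = 1 ∨ ε = -1) ∧
      ((gaussPow p ρ⁻¹ : 𝓞 K) : K) ^ p = galPow (A : K) (P v σ) * ε := by
  obtain ⟨U, hU⟩ := exists_mul_galPow_P_eq hζ hv hσ hp2 h𝔮 hqp hρp hρ1 hρ hA0 hA𝔮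
  set G : K := ((gaussPow p ρ⁻¹ : 𝓞 K) : K) with hGdef
  set m : K := (Nat.card (𝓞 K ⧸ 𝔮) : K) with hm
  have hm0 : m ≠ 0 := by
    rw [hm]
    exact_mod_cast Nat.card_pos.ne'
  have hG0 : G ≠ 0 := fun h => by
    rw [h, mul_zero] at hGG
    exact pow_ne_zero p hm0 hGG.symm
  have hAP0 := galPow_ne_zero hA0 (P v σ)
  refine ⟨U, ?_, hU⟩
  have hU' : (U : K) = (galPow (A : K) (P v σ))⁻¹ * G ^ p := by
    rw [hU, inv_mul_cancel_left₀ hAP0]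
  refine IsSemiprimary.eq_one_or_eq_neg_one hζ hp2 ?_ ?_
  · rw [hU', ← zpow_natCast]
    exact ((hA.galPow hζ hA0 _).inv hAP0).mul (hG.zpow hG0 _)
  · refine isOfFinOrder_of_conj_mul hJ U.isIntegral_coe ?_
    have h1 : (m ^ p) ^ p = (algebraMap ℚ K (Algebra.norm ℚ (A : K))) ^ p * (J U * U) := by
      rw [← galPow_P_mul_conj hζ hv hσ hp2 hJ hA0, ← hGG, mul_pow, ← map_pow, hU, map_mul]
      ring
    have hodd := hp.out.odd_of_ne_two hp2
    rcases norm_eq_or_eq_neg hA𝔮 with h | h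
    · rw [h, map_pow, map_natCast, ← hm] at h1
      exact Or.inl ((mul_eq_left₀ (pow_ne_zero _ (pow_ne_zero _ hm0))).1 h1.symm)
    · rw [h, map_neg, map_pow, map_natCast, ← hm, hodd.neg_pow, neg_mul, ← mul_neg] at h1
      exact Or.inr (by
        rw [← (mul_eq_left₀ (pow_ne_zero _ (pow_ne_zero _ hm0))).1 h1.symm, neg_neg])

include hv hσ hζ in
/-- The second assertion follows from the first by extracting a `p`-th root among semiprimary
numbers. -/
theorem galPow_eq_of_pow_eq (hp2 : p ≠ 2) (hJ : ∀ φ : K →+* ℂ, ComplexEmbedding.IsConj φ J)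
    {G A ε : K} (hG0 : G ≠ 0) (hA0 : A ≠ 0) (hG : IsSemiprimary p (hζ.toInteger - 1) G)
    (hA : IsSemiprimary p (hζ.toInteger - 1) A) (hε : ε = 1 ∨ ε = -1)
    (h : G ^ p = galPow A (P v σ) * ε) :
    galPow G ((grp σ - 1) * (grp σ - vpow v 1 • 1)) = galPow (J A / A) (Q₁ v σ) ∨
      galPow G ((grp σ - 1) * (grp σ - vpow v 1 • 1)) = -galPow (J A / A) (Q₁ v σ) := by
  have hs : grp σ ^ (p - 1) = 1 := by
    rw [grp_pow, sigma_pow_sub_one hζ hv hσ]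
    rfl
  set y := galPow G (grp σ - vpow v 1 • 1) with hy
  set a := galPow A (Q v (grp σ)) with ha
  have ha0 : a ≠ 0 := galPow_ne_zero hA0 _
  have hyp : y ^ p = a ^ p * galPow ε (grp σ - vpow v 1 • 1) := by
    rw [hy, ← galPow_pow, h, galPow_mul_left, ← galPow_mul hA0, P, sub_mul_sum_vpow hv hs,
      galPow_natCast_smul hA0]
  obtain ⟨η, hη, hηy⟩ : ∃ η : K, (η = 1 ∨ η = -1) ∧ y = a * η := by
    refine ⟨a⁻¹ * y, ?_, (mul_inv_cancel_left₀ ha0 y).symm⟩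
    refine IsSemiprimary.eq_one_or_eq_neg_one hζ hp2
      (((hA.galPow hζ hA0 _).inv ha0).mul (hG.galPow hζ hG0 _)) ?_
    have h1 : (a⁻¹ * y) ^ p = galPow ε (grp σ - vpow v 1 • 1) := by
      rw [mul_pow, hyp, inv_pow, inv_mul_cancel_left₀ (pow_ne_zero _ ha0)]
    refine isOfFinOrder_iff_pow_eq_one.2 ⟨p * 2, by have := hp.out.pos; lia, ?_⟩
    rw [pow_mul, h1, sq_eq_one_iff]
    exact galPow_sign hε _
  have hfin : galPow a (grp σ - 1) = galPow (J A / A) (Q₁ v σ) := by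
    rw [ha, ← galPow_mul hA0, sub_one_mul_Q hv hp2, ← Q₁, galPow_mul hA0, galPow_sub hA0,
      galPow_one, grp_pow, galPow_grp, ← conj_eq_sigma_pow hζ hv hσ hp2 hJ]
  rw [galPow_mul hG0, ← hy, hηy, galPow_mul_left, hfin]
  rcases galPow_sign hη (grp σ - 1) with h | h <;> rw [h] <;> simp

end Main

end KummerStickelberger

open KummerStickelberger NumberField in
theorem theoremt601311
    (p : ℕ) [Fact p.Prime] (hp2 : p ≠ 2)
    (K : Type*) [Field K] [NumberField K] [IsCyclotomicExtension {p} ℚ K]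
    (ζ : K) (hζ : IsPrimitiveRoot ζ p)
    -- a primitive root `v` modulo `p`, the automorphism `σ : ζ ↦ ζ ^ v`, complex conjugation `J`
    (v : (ZMod p)ˣ) (hv : ∀ u : (ZMod p)ˣ, u ∈ Subgroup.zpowers v)
    (σ : K ≃ₐ[ℚ] K) (hσ : σ ζ = ζ ^ (v : ZMod p).val)
    (J : K ≃ₐ[ℚ] K) (hJ : ∀ φ : K →+* ℂ, ComplexEmbedding.IsConj φ J)
    -- a subgroup `Γ` of order `p` of the class group, annihilated by `σ - μ`, `μ = v ^ n`
    (Γ : Subgroup (ClassGroup (𝓞 K))) (hΓ : Nat.card Γ = p)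
    (μ : (ZMod p)ˣ) (hμ : IsAnnihilatedBy Γ σ μ)
    (n : ℕ) (hn1 : 1 < n) (hn2 : n ≤ p - 2) (hμn : μ = v ^ n)
    -- a prime `𝔮` over `q` whose class is in `Γ`
    (q : ℕ) [Fact q.Prime] (hq2 : q ≠ 2) (hqp : q ≠ p)
    (𝔮 : Ideal (𝓞 K)) [𝔮.IsPrime] [𝔮.LiesOver (Ideal.span {(q : ℤ)})] (h𝔮 : 𝔮 ≠ ⊥)
    (h𝔮Γ : ClassGroup.mk0 ⟨𝔮, mem_nonZeroDivisors_of_ne_zero h𝔮⟩ ∈ Γ)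
    -- a singular `A` generating `𝔮 ^ p`, congruent to a natural number modulo `π ^ n`
    (A : 𝓞 K) (hA : IsSingular p A) (hA𝔮 : Ideal.span {A} = 𝔮 ^ p)
    (hAπ : ∃ a : ℕ, A - (a : 𝓞 K) ∈ Ideal.span {hζ.toInteger - 1} ^ n)
    -- the field `L = K(ζ_q)`
    (L : Type*) [Field L] [Algebra K L] [IsCyclotomicExtension {q} K L]
    (ζq : L) (hζq : IsPrimitiveRoot ζq q) :
    (gauss p q 𝔮 ζq ^ (p ^ 2) = algebraMap K L (galPow (A : K) (P v σ)) ∨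
      gauss p q 𝔮 ζq ^ (p ^ 2) = -algebraMap K L (galPow (A : K) (P v σ))) ∧
    -- `G` is the element `g(𝔮) ^ p` of `ℤ[ζ]`
    ∃ G : 𝓞 K, algebraMap K L (G : K) = gauss p q 𝔮 ζq ^ p ∧
      (galPow (G : K) ((grp σ - 1) * (grp σ - vpow v 1 • 1)) =
          galPow (J (A : K) / (A : K)) (Q₁ v σ) ∨
        galPow (G : K) ((grp σ - 1) * (grp σ - vpow v 1 • 1)) =
          -galPow (J (A : K) / (A : K)) (Q₁ v σ)) := by
  have hGcard := dvd_card_quotient_sub_one hζ h𝔮 hqp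
  have h𝔮max : 𝔮.IsMaximal := isMaximal_of_liesOver (q := q)
  let := Ideal.Quotient.field 𝔮
  have : Finite (𝓞 K ⧸ 𝔮) := Ideal.finiteQuotientOfFreeOfNeBot 𝔮 h𝔮
  let := Fintype.ofFinite (𝓞 K ⧸ 𝔮)
  obtain ⟨ρ, hρp, hρ1, hρ, hρsymb⟩ := exists_mulChar_powerResidue hζ h𝔮 hqp
  obtain ⟨a, ha⟩ := hAπ
  set G : 𝓞 K := gaussPow p ρ⁻¹ with hG
  let toL : 𝓞 K →+* L := (algebraMap K L).comp (algebraMap (𝓞 K) K)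
  have htoL : Function.Injective toL :=
    (algebraMap K L).injective.comp (FaithfulSMul.algebraMap_injective (𝓞 K) K)
  have hψ := residueAddChar_ne_one (𝔮 := 𝔮) hζq
  have hχ1 : ρ⁻¹.ringHomComp toL ≠ 1 :=
    (MulChar.ringHomComp_ne_one_iff htoL).2 (inv_ne_one.2 hρ1)
  have hχp : ρ⁻¹.ringHomComp toL ^ p = 1 := by
    rw [MulChar.ringHomComp_pow, inv_pow, hρp, inv_one, MulChar.ringHomComp_one]
  have hgauss : algebraMap K L (G : K) = gauss p q 𝔮 ζq ^ p := by
    rw [gauss_eq_gaussSum hρsymb hζq.pow_eq_one, gaussSum_pow_eq_gaussPow hχ1 hχp hψ,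
      gaussPow_ringHomComp]
    rfl
  -- `J G` is the `p`-th power of the Gauss sum of the inverse character
  have hGG : J (G : K) * (G : K) = (Nat.card (𝓞 K ⧸ 𝔮) : K) ^ p := by
    have h1 : act J G = gaussPow p ρ := by
      rw [hG, act_gaussPow hζ (by rw [inv_pow, hρp, inv_one]), conj_eq_sigma_pow hζ hv hσ hp2 hJ,
        map_pow, autToPow_eq hζ hσ, pow_half_eq_neg_one hv hp2, Units.val_neg, Units.val_one,
        ZMod.val_neg_of_ne_zero, ZMod.val_one, inv_pow]
      congr 1
      refine inv_eq_of_mul_eq_one_right ?_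
      rw [← pow_succ, Nat.sub_add_cancel (Fact.out : p.Prime).one_le, hρp]
    have h2 : act J G * G = (Fintype.card (𝓞 K ⧸ 𝔮) : 𝓞 K) ^ p := by
      apply htoL
      have h3 := gaussPow_mul_gaussPow_inv hp2 hχ1 hχp hψ
      rw [MulChar.ringHomComp_inv, inv_inv, gaussPow_ringHomComp, gaussPow_ringHomComp] at h3
      rw [map_mul, map_pow, map_natCast, ← h3, h1, mul_comm]
    have h4 := congrArg (algebraMap (𝓞 K) K) h2
    rw [map_mul, map_pow, map_natCast, ← Nat.card_eq_fintype_card] at h4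
    exact h4
  have hA0 : (A : K) ≠ 0 := by
    intro h
    have hA0 : A = 0 := RingOfIntegers.ext h
    rw [hA0, Set.singleton_zero, Ideal.span_zero] at hA𝔮
    exact pow_ne_zero p h𝔮 hA𝔮.symm
  have hG0 : (G : K) ≠ 0 := by
    intro h
    rw [h, mul_zero] at hGG
    exact pow_ne_zero p (by exact_mod_cast Nat.card_pos.ne') hGG.symm
  have hGsemi : IsSemiprimary p (hζ.toInteger - 1) (G : K) :=
    isSemiprimary_gaussPow hζ hp2 (by rwa [← Nat.card_eq_fintype_card])
      (by rw [inv_pow, hρp, inv_one])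
  have hAsemi := isSemiprimary_of_span_eq hζ hqp hA𝔮 hn1 ha
  obtain ⟨ε, hε, h⟩ := gaussPow_pow_eq hζ hv hσ hp2 hJ h𝔮 hqp hρp hρ1 hρ hA0 hA𝔮 hAsemi hGsemi hGG
  refine ⟨?_, G, hgauss, galPow_eq_of_pow_eq hζ hv hσ hp2 hJ hG0 hA0 hGsemi hAsemi hε h⟩
  rw [sq, pow_mul, ← hgauss, ← map_pow, h]
  rcases hε with rfl | rfl <;> simp
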